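/- Let $0\le d\le n$. Let $\widetilde G^n_d$ be the oriented Grassmannian, i.e. the set of oriented $d$-dimensional subspaces $T$ of $\mathbb{R}^n$, identified through $T\mapsto u_1\wedge\dots\wedge u_d/|u_1\wedge\dots\wedge u_d|$ ($u$ a positively oriented basis of $T$) with a subset of the unit sphere of $\Lambda^d(\mathbb{R}^n)$, from which it inherits its topology and the inner product $\langle S,T\rangle$. An oriented $d$-varifold is a finite nonnegative Borel measure $\mu$ on $\mathbb{R}^n\times\widetilde G^n_d$; its weight measure is $|\mu|(A)=\mu(A\times\widetilde G^n_d)$. For a $C^1$-diffeomorphism $\phi$ of $\mathbb{R}^n$ the pushforward $\phi_\#\mu$ is defined by $$\int\omega\,d(\phi_\#\mu)=\int\omega(\phi(x),d_x\phi\cdot T)\,J_T\phi(x)\,d\mu(x,T),$$ where $A\cdot T$ is the oriented plane spanned by $Au_1,\dots,Au_d$ and $J_T\phi(x)=\det\big((d_x\phi(e_i)\cdot d_x\phi(e_j))_{i,j}\big)^{1/2}$ for an orthonormal basis $(e_i)$ of $T$. Let $\rho,\gamma$ be real functions, nonnegative on $[0,\infty)$ and on $[-1,1]$ respectively, with $\rho(0)>0$,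 such that $k^{pos}(x,y)=\rho(|x-y|^2)$ and $k^G(S,T)=\gamma(\langle S,T\rangle)$ are continuous positive definite kernels on $\mathbb{R}^n$ and $\widetilde G^n_d$ (i.e. symmetric with $\sum_{i,j}c_ic_jk(z_i,z_j)\ge 0$), and such that $k^{pos}(x,\cdot)$ vanishes at infinity for every $x$. Let $W$ be the reproducing kernel Hilbert space (RKHS) on $\mathbb{R}^n\times\widetilde G^n_d$ with kernel $k((x,S),(y,T))=\rho(|x-y|^2)\gamma(\langle S,T\rangle)$, and suppose that $k$ is $C_0$-universal, i.e. that $W$ is dense in $C_0(\mathbb{R}^n\times\widetilde G^n_d)$ for uniform convergence. Write $$\|\mu-\nu\|_{W^*}=\sup_{\omega\in W,\ \|\omega\|_W\le1}\Big(\int\omega\,d\mu-\int\omega\,d\nu\Big).$$ Let $V$ be an RKHS of vector fields on $\mathbb{R}^n$ that is continuously embedded in $C_0^2(\mathbb{R}^n,\mathbb{R}^n)$. For $v\in L^2([0,1],V)$ let $\varphi^v_t$, $t\in[0,1]$, be its flow, i.e. $\varphi^v_t(x)=x+\int_0^tv_s(\varphi^v_s(x))\,ds$. Let $\mu_0,\mu_{tar}$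 be oriented $d$-varifolds, $\lambda\ge0$, and let $K\subset\mathbb{R}^n$ be a compact set that contains $\mathrm{supp}(|\mu_0|)$. For every $N\ge1$ let $\mu_{K,N}$ be a minimizer of $\|\nu-\mu_0\|_{W^*}$ among all $\nu=\sum_{i=1}^Nr_i\delta_{(x_i,T_i)}$ with $r_i\ge0$, $x_i\in\mathbb{R}^n$, $T_i\in\widetilde G^n_d$ and $\mathrm{supp}(|\nu|)\subset K$. For $v\in L^2([0,1],V)$ put $$E(v)=\tfrac12\int_0^1\|v_t\|_V^2\,dt+\lambda\|(\varphi^v_1)_\#\mu_0-\mu_{tar}\|_{W^*}^2,\qquad E_N(v)=\tfrac12\int_0^1\|v_t\|_V^2\,dt+\lambda\|(\varphi^v_1)_\#\mu_{K,N}-\mu_{tar}\|_{W^*}^2 .$$ Then $E_N$ $\Gamma$-converges to $E$ for the weak topology of $L^2([0,1],V)$: if $v^N\rightharpoonup\bar v$ weakly then $E(\bar v)\le\liminf_NE_N(v^N)$, and for every $\bar v$ there is a sequence $v^N\rightharpoonup\bar v$ with $\limsup_NE_N(v^N)\le E(\bar v)$. Moreover, if $v^N$ is a global minimizer of $E_N$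 for every $N\ge1$, then $(v^N)_{N\ge1}$ is bounded in $L^2([0,1],V)$, and every cluster point of $(v^N)$ for the weak topology of $L^2([0,1],V)$ is a global minimizer of $E$. -/

import Mathlib

open MeasureTheory Set Filter Topology
open scoped ENNReal NNReal ZeroAtInfty

/-- `ℝⁿ` with its Euclidean structure. -/
abbrev Eucl (n : ℕ) : Type := EuclideanSpace ℝ (Fin n)

/-! ### The oriented Grassmannian -/

/-- The oriented Grassmannian of `d`-planes in `ℝⁿ`, as the image of the oriented Plücker embedding
in the unit sphere of `Λᵈ(ℝⁿ)`: the oriented plane with positively oriented basis `u₁, …, u_d` is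
`u₁ ∧ ⋯ ∧ u_d / |u₁ ∧ ⋯ ∧ u_d|`. The metric and the inner product `⟨S, T⟩` are those of
`Λᵈ(ℝⁿ)` (whose inner product is given by Gram determinants). -/
abbrev OrientedGrassmannian (n d : ℕ) : Type :=
  {ξ : ⋀[ℝ]^d (Eucl n) // ∃ u : Fin d → Eucl n, LinearIndependent ℝ u ∧
    ξ = ‖exteriorPower.ιMulti ℝ d u‖⁻¹ • exteriorPower.ιMulti ℝ d u}

noncomputable instance (n d : ℕ) : MeasurableSpace (OrientedGrassmannian n d) := borel _

instance (n d : ℕ) : BorelSpace (OrientedGrassmannian n d) := ⟨rfl⟩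

/-- The space `ℝⁿ × G̃` that carries the oriented `d`-varifolds. An oriented `d`-varifold is a finite
measure on it. -/
abbrev VarifoldSpace (n d : ℕ) : Type := Eucl n × OrientedGrassmannian n d

lemma OrientedGrassmannian.act_aux {n d : ℕ} (A : Eucl n →L[ℝ] Eucl n)
    (T : OrientedGrassmannian n d) (h : exteriorPower.map d (A : Eucl n →ₗ[ℝ] Eucl n) T.1 ≠ 0) :
    ∃ u : Fin d → Eucl n, LinearIndependent ℝ u ∧
      ‖exteriorPower.map d (A : Eucl n →ₗ[ℝ] Eucl n) T.1‖⁻¹ •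
          exteriorPower.map d (A : Eucl n →ₗ[ℝ] Eucl n) T.1 =
        ‖exteriorPower.ιMulti ℝ d u‖⁻¹ • exteriorPower.ιMulti ℝ d u := by
  obtain ⟨ξ, u, hu, rfl⟩ := T
  simp only [map_smul, exteriorPower.map_apply_ιMulti] at h ⊢
  have hc : ‖exteriorPower.ιMulti ℝ d u‖⁻¹ ≠ 0 := fun h0 => h (by rw [h0, zero_smul])
  have hw : exteriorPower.ιMulti ℝ d (⇑(A : Eucl n →ₗ[ℝ] Eucl n) ∘ u) ≠ 0 :=
    fun h0 => h (by rw [h0, smul_zero])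
  refine ⟨⇑(A : Eucl n →ₗ[ℝ] Eucl n) ∘ u, ?_, ?_⟩
  · by_contra hdep
    exact hw (AlternatingMap.map_linearDependent _ _ hdep)
  · rw [norm_smul, norm_inv, norm_norm, smul_smul, mul_inv, mul_right_comm, inv_mul_cancel₀ ?_,
      one_mul]
    exact inv_ne_zero (fun h0 => hc (by rw [h0, inv_zero]))

open Classical in
/-- The action `A · T = (A u₁ ∧ ⋯ ∧ A u_d) / |A u₁ ∧ ⋯ ∧ A u_d|` of a linear map that is injective
on `T` (in particular of an invertible one); other maps are made to fix `T`. -/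
noncomputable def OrientedGrassmannian.act {n d : ℕ} (A : Eucl n →L[ℝ] Eucl n)
    (T : OrientedGrassmannian n d) : OrientedGrassmannian n d :=
  if h : exteriorPower.map d (A : Eucl n →ₗ[ℝ] Eucl n) T.1 = 0 then T
  else ⟨‖exteriorPower.map d (A : Eucl n →ₗ[ℝ] Eucl n) T.1‖⁻¹ •
      exteriorPower.map d (A : Eucl n →ₗ[ℝ] Eucl n) T.1, T.act_aux A h⟩

/-- The change of `d`-volume of the linear map `A` along `T`, that is `|A e₁ ∧ ⋯ ∧ A e_d|` for an
orthonormal oriented basis `e` of `T`. -/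
noncomputable def OrientedGrassmannian.jac {n d : ℕ} (A : Eucl n →L[ℝ] Eucl n)
    (T : OrientedGrassmannian n d) : ℝ :=
  ‖exteriorPower.map d (A : Eucl n →ₗ[ℝ] Eucl n) T.1‖

/-- `jac` is the square root of the Gram determinant. -/
lemma OrientedGrassmannian.jac_eq_sqrt_det_gram {n d : ℕ} (A : Eucl n →L[ℝ] Eucl n)
    (T : OrientedGrassmannian n d) (e : Fin d → Eucl n)
    (hT : T.1 = exteriorPower.ιMulti ℝ d e) :
    T.jac A = Real.sqrt (Matrix.det (Matrix.gram ℝ (fun i => A (e i)))) := by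
  rw [OrientedGrassmannian.jac, hT, exteriorPower.map_apply_ιMulti, norm_eq_sqrt_real_inner,
    exteriorPower.inner_ιMulti_self]
  rfl

/-! ### Varifolds: pushforward, discrete varifolds, weight measure -/

/-- The pushforward `φ_# μ` of a varifold by a diffeomorphism:
`(φ_# μ | ω) = ∫ ω(φ(x), d_xφ · T) J_T φ(x) dμ(x, T)`. -/
noncomputable def varifoldPushforward {n d : ℕ} (φ : Eucl n → Eucl n)
    (μ : Measure (VarifoldSpace n d)) : Measure (VarifoldSpace n d) :=
  (μ.withDensity (fun p => ENNReal.ofReal (p.2.jac (fderiv ℝ φ p.1)))).map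
    (fun p => (φ p.1, p.2.act (fderiv ℝ φ p.1)))

/-- The weight measure `|μ|(A) = μ(A × G̃)`. -/
noncomputable def weightMeasure {n d : ℕ} (μ : Measure (VarifoldSpace n d)) : Measure (Eucl n) :=
  μ.map Prod.fst

/-- The discrete varifolds with at most `N` Diracs. -/
def discreteVarifolds (n d N : ℕ) : Set (Measure (VarifoldSpace n d)) :=
  {μ | ∃ (r : Fin N → ℝ≥0) (x : Fin N → Eucl n) (T : Fin N → OrientedGrassmannian n d),
    μ = ∑ i, r i • Measure.dirac (x i, T i)}

/-! ### Kernels and kernel metrics -/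

/-- The kernel `k((x, S), (y, T)) = ρ(|x - y|²) γ(⟨S, T⟩)`. -/
noncomputable def varifoldKernel {n d : ℕ} (ρ γ : ℝ → ℝ) (p q : VarifoldSpace n d) : ℝ :=
  ρ (‖p.1 - q.1‖ ^ 2) * γ (inner ℝ p.2.1 q.2.1)

/-- The conditions on the radial functions `ρ` and `γ` that define the position kernel
`ρ(|x - y|²)` on `ℝⁿ` and the Grassmannian kernel `γ(⟨S, T⟩)`. -/
structure KernelConditions (n d : ℕ) (ρ γ : ℝ → ℝ) : Prop where
  pos_continuous : Continuous (fun p : Eucl n × Eucl n => ρ (‖p.1 - p.2‖ ^ 2))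
  pos_posDef : (Matrix.of fun x y : Eucl n => ρ (‖x - y‖ ^ 2)).PosSemidef
  pos_zero_at_infty : ∀ x : Eucl n,
    Tendsto (fun y => ρ (‖x - y‖ ^ 2)) (cocompact (Eucl n)) (𝓝 0)
  grass_continuous : Continuous
    (fun p : OrientedGrassmannian n d × OrientedGrassmannian n d => γ (inner ℝ p.1.1 p.2.1))
  grass_posDef : (Matrix.of fun S T : OrientedGrassmannian n d => γ (inner ℝ S.1 T.1)).PosSemidef
  rho_zero_pos : 0 < ρ 0
  rho_nonneg : ∀ s, 0 ≤ s → 0 ≤ ρ s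
  gamma_nonneg : ∀ t ∈ Icc (-1 : ℝ) 1, 0 ≤ γ t

/-- The kernel of a reproducing kernel Hilbert space `W` of real functions on `X` is
`C₀`-universal: `W` is dense in `C₀(X)` for uniform convergence. -/
def IsC0Universal {X : Type*} [TopologicalSpace X] (W : Type*) [NormedAddCommGroup W]
    [InnerProductSpace ℝ W] [RKHS ℝ W X ℝ] : Prop :=
  Dense {f : C₀(X, ℝ) | ∃ ω : W, ∀ p, ω p = f p}

/-- `‖μ - ν‖_{W*}`, the norm of `ω ↦ ∫ ω dμ - ∫ ω dν` in the dual of `W`. -/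
noncomputable def dualDist {X : Type*} [MeasurableSpace X] (W : Type*) [NormedAddCommGroup W]
    [InnerProductSpace ℝ W] [RKHS ℝ W X ℝ] (μ ν : Measure X) : ℝ :=
  sSup ((fun ω : W => (∫ p, ω p ∂μ) - ∫ p, ω p ∂ν) '' Metric.closedBall 0 1)

/-- `ν` is a best approximation of `μ₀` for `‖·‖_{W*}` among the varifolds with at most `N` Diracs
and whose weight measure has its support in `K`. -/
def IsConstrainedProjection {n d : ℕ} (W : Type*) [NormedAddCommGroup W]
    [InnerProductSpace ℝ W] [RKHS ℝ W (VarifoldSpace n d) ℝ] (μ₀ : Measure (VarifoldSpace n d))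
    (K : Set (Eucl n)) (N : ℕ) (ν : Measure (VarifoldSpace n d)) : Prop :=
  ν ∈ discreteVarifolds n d N ∧ (weightMeasure ν).support ⊆ K ∧
    ∀ ν' ∈ discreteVarifolds n d N, (weightMeasure ν').support ⊆ K →
      dualDist W ν μ₀ ≤ dualDist W ν' μ₀

/-! ### Velocity fields and flows -/

/-- The space `V` of vector fields is continuously embedded in `C₀²(ℝⁿ, ℝⁿ)`, the space of `C²`
fields that vanish at infinity with their derivatives of order at most 2. -/
def EmbedsInC02 {n : ℕ} (V : Type*) [NormedAddCommGroup V] [InnerProductSpace ℝ V]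
    [RKHS ℝ V (Eucl n) (Eucl n)] : Prop :=
  (∀ v : V, ContDiff ℝ 2 v ∧
    ∀ j ≤ 2, Tendsto (iteratedFDeriv ℝ j v) (cocompact (Eucl n)) (𝓝 0)) ∧
  ∃ C : ℝ, ∀ v : V, ∀ j ≤ 2, ∀ x, ‖iteratedFDeriv ℝ j v x‖ ≤ C * ‖v‖

/-- `L²([0,1], V)`. -/
abbrev L2Path (V : Type*) [NormedAddCommGroup V] : Type _ :=
  Lp V 2 ((volume : Measure ℝ).restrict (Icc 0 1))

/-- `φ` is a flow of the time-dependent field `v` on `[0,1]`: `∂ₜ φₜ = vₜ ∘ φₜ`, `φ₀ = id`. As `v` is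
only square integrable in time, the equation is meant in integrated form. -/
def IsFlow {n : ℕ} {V : Type*} [NormedAddCommGroup V] [InnerProductSpace ℝ V]
    [RKHS ℝ V (Eucl n) (Eucl n)] (v : ℝ → V) (φ : ℝ → Eucl n → Eucl n) : Prop :=
  ∀ x, ContinuousOn (fun t => φ t x) (Icc 0 1) ∧
    ∀ t ∈ Icc (0 : ℝ) 1, IntervalIntegrable (fun s => (v s) (φ s x)) volume 0 t ∧
      φ t x = x + ∫ s in (0 : ℝ)..t, (v s) (φ s x)

/-- The flow `φᵛ` (it exists and is unique on `[0,1]` if `V` is embedded in `C₀¹`). -/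
noncomputable def flow {n : ℕ} {V : Type*} [NormedAddCommGroup V] [InnerProductSpace ℝ V]
    [RKHS ℝ V (Eucl n) (Eucl n)] (v : L2Path V) : ℝ → Eucl n → Eucl n :=
  Classical.epsilon (fun φ => IsFlow (v : ℝ → V) φ)

/-- The registration energy
`½ ∫₀¹ ‖v_t‖² dt + lam ‖(φ₁ᵛ)_# μ - μtar‖²_{W*}` with source `μ` and target `μtar`. -/
noncomputable def registrationEnergy {n d : ℕ} {V : Type*} [NormedAddCommGroup V]
    [InnerProductSpace ℝ V] [RKHS ℝ V (Eucl n) (Eucl n)] (W : Type*) [NormedAddCommGroup W]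
    [InnerProductSpace ℝ W] [RKHS ℝ W (VarifoldSpace n d) ℝ] (lam : ℝ)
    (μ μtar : Measure (VarifoldSpace n d)) (v : L2Path V) : ℝ :=
  (1 / 2) * (∫ t in Icc (0 : ℝ) 1, ‖v t‖ ^ 2) +
    lam * dualDist W (varifoldPushforward (flow v 1) μ) μtar ^ 2

/-! ### Gamma-convergence -/

/-- `Γ`-convergence of `F N` to `G` on a topological space: the lower bound along every convergent
sequence, and the existence of recovery sequences. -/
def GammaConverges {X : Type*} [TopologicalSpace X] (F : ℕ → X → ℝ) (G : X → ℝ) : Prop :=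
  (∀ (x : X) (u : ℕ → X), Tendsto u atTop (𝓝 x) →
    (G x : EReal) ≤ liminf (fun N => (F N (u N) : EReal)) atTop) ∧
  (∀ x : X, ∃ u : ℕ → X, Tendsto u atTop (𝓝 x) ∧
    limsup (fun N => (F N (u N) : EReal)) atTop ≤ (G x : EReal))

/-! ### Gronwall's inequality and ordinary differential equations with integrable coefficients -/

section Caratheodory

variable {L : ℝ → ℝ}

lemma monotoneOn_primitive (hL : Integrable L) (hL0 : ∀ t, 0 ≤ L t) :
    MonotoneOn (fun t => ∫ s in (0 : ℝ)..t, L s) (Ici 0) := by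
  intro s hs t ht hst
  exact intervalIntegral.integral_mono_interval le_rfl hs hst (Eventually.of_forall hL0)
    hL.intervalIntegrable

lemma primitive_nonneg (hL0 : ∀ t, 0 ≤ L t) {t : ℝ} (ht : 0 ≤ t) :
    0 ≤ ∫ s in (0 : ℝ)..t, L s :=
  intervalIntegral.integral_nonneg ht fun s _ => hL0 s

lemma continuous_primitive_of_integrable (hL : Integrable L) :
    Continuous (fun t => ∫ s in (0 : ℝ)..t, L s) :=
  intervalIntegral.continuous_primitive (fun _ _ => hL.intervalIntegrable) 0

lemma intervalIntegrable_mul_continuous (hL : Integrable L) {u : ℝ → ℝ} {a b : ℝ}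
    (hab : a ≤ b) (hu : ContinuousOn u (Icc a b)) :
    IntervalIntegrable (fun s => L s * u s) volume a b :=
  hL.intervalIntegrable.mul_continuousOn (by rwa [uIcc_of_le hab])

lemma integral_mul_exp_primitive_le (hL : Integrable L) (hL0 : ∀ t, 0 ≤ L t) {t : ℝ}
    (ht : 0 ≤ t) :
    ∫ s in (0 : ℝ)..t, L s * Real.exp (2 * ∫ r in (0 : ℝ)..s, L r) ≤
      Real.exp (2 * ∫ r in (0 : ℝ)..t, L r) / 2 := by
  set g : ℝ → ℝ := fun s => Real.exp (2 * ∫ r in (0 : ℝ)..s, L r) with hg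
  have hmono : MonotoneOn g (uIcc 0 t) := by
    rw [uIcc_of_le ht]
    intro r hr s hs hrs
    have := monotoneOn_primitive hL hL0 (mem_Ici.2 hr.1) (mem_Ici.2 hs.1) hrs
    exact Real.exp_le_exp.2 (by simpa using this)
  have hmem := hmono.intervalIntegral_deriv_mem_uIcc
  have hg0 : g 0 ≤ g t := hmono left_mem_uIcc right_mem_uIcc ht
  rw [uIcc_of_le (by linarith)] at hmem
  have hderiv : ∫ s in (0 : ℝ)..t, deriv g s = ∫ s in (0 : ℝ)..t, 2 * (L s * g s) := by
    apply intervalIntegral.integral_congr_ae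
    filter_upwards [_root_.LocallyIntegrable.ae_hasDerivAt_integral hL.locallyIntegrable] with s hs _
    have := ((hs 0).const_mul 2).exp
    rw [this.deriv]
    ring
  rw [hderiv, intervalIntegral.integral_const_mul] at hmem
  have hg00 : 0 ≤ g 0 := (Real.exp_pos _).le
  linarith [hmem.2]

/-- Gronwall's inequality in integral form, with an integrable coefficient. -/
lemma gronwall_integral (hL : Integrable L) (hL0 : ∀ t, 0 ≤ L t) {u : ℝ → ℝ} {a : ℝ}
    (ha : 0 ≤ a) (hu : ContinuousOn u (Icc 0 1)) (hu0 : ∀ t ∈ Icc (0 : ℝ) 1, 0 ≤ u t)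
    (h : ∀ t ∈ Icc (0 : ℝ) 1, u t ≤ a + ∫ s in (0 : ℝ)..t, L s * u s) :
    ∀ t ∈ Icc (0 : ℝ) 1, u t ≤ 2 * a * Real.exp (2 * ∫ s in (0 : ℝ)..1, L s) := by
  set ℓ : ℝ → ℝ := fun t => ∫ s in (0 : ℝ)..t, L s with hℓ
  have hℓc : Continuous ℓ := continuous_primitive_of_integrable hL
  have hec : Continuous fun t => Real.exp (2 * ℓ t) := by fun_prop
  have hec' : Continuous fun t => Real.exp (-(2 * ℓ t)) := by fun_prop
  obtain ⟨t₀, ht₀, hmax⟩ := isCompact_Icc.exists_isMaxOn (nonempty_Icc.2 zero_le_one)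
    (hu.mul hec'.continuousOn)
  set M := u t₀ * Real.exp (-(2 * ℓ t₀)) with hM
  have hM0 : 0 ≤ M := mul_nonneg (hu0 _ ht₀) (Real.exp_pos _).le
  have hle : ∀ s ∈ Icc (0 : ℝ) 1, u s ≤ M * Real.exp (2 * ℓ s) := by
    intro s hs
    have h1 : u s * Real.exp (-(2 * ℓ s)) ≤ M := hmax hs
    have h2 := mul_le_mul_of_nonneg_right h1 (Real.exp_pos (2 * ℓ s)).le
    rwa [mul_assoc, ← Real.exp_add, neg_add_cancel, Real.exp_zero, mul_one] at h2
  have hint : ∫ s in (0 : ℝ)..t₀, L s * u s ≤ M * (Real.exp (2 * ℓ t₀) / 2) := by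
    calc ∫ s in (0 : ℝ)..t₀, L s * u s
        ≤ ∫ s in (0 : ℝ)..t₀, M * (L s * Real.exp (2 * ℓ s)) := by
          refine intervalIntegral.integral_mono_on ht₀.1
            (intervalIntegrable_mul_continuous hL ht₀.1
              (hu.mono (Icc_subset_Icc_right ht₀.2)))
            ((intervalIntegrable_mul_continuous hL ht₀.1 hec.continuousOn).const_mul M) ?_
          intro s hs
          have := mul_le_mul_of_nonneg_left (hle s ⟨hs.1, hs.2.trans ht₀.2⟩) (hL0 s)
          linarith
      _ = M * ∫ s in (0 : ℝ)..t₀, L s * Real.exp (2 * ℓ s) :=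
          intervalIntegral.integral_const_mul _ _
      _ ≤ _ := mul_le_mul_of_nonneg_left (integral_mul_exp_primitive_le hL hL0 ht₀.1) hM0
  have hut : u t₀ = M * Real.exp (2 * ℓ t₀) := by
    rw [hM, mul_assoc, ← Real.exp_add, neg_add_cancel, Real.exp_zero, mul_one]
  have hM2 : M ≤ 2 * a := by
    have h1 := h t₀ ht₀
    have h2 : 1 ≤ Real.exp (2 * ℓ t₀) :=
      Real.one_le_exp (mul_nonneg zero_le_two (primitive_nonneg hL0 ht₀.1))
    nlinarith
  intro t ht
  have hmono : ℓ t ≤ ℓ 1 := monotoneOn_primitive hL hL0 (mem_Ici.2 ht.1)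
    (mem_Ici.2 zero_le_one) ht.2
  calc u t ≤ M * Real.exp (2 * ℓ t) := hle t ht
    _ ≤ 2 * a * Real.exp (2 * ℓ 1) := by gcongr

variable {F : Type*} [NormedAddCommGroup F] [NormedSpace ℝ F] [CompleteSpace F]

/-- Existence of solutions on `[0,1]` of an integral equation `y t = x₀ + ∫₀ᵗ f s (y s) ds` whose
right-hand side is Lipschitz in space with a constant that is integrable in time. -/
lemma exists_integral_equation_solution (hL : Integrable L) (hL0 : ∀ t, 0 ≤ L t)
    (f : ℝ → F → F) (hLip : ∀ t ∈ Icc (0 : ℝ) 1, ∀ x y, ‖f t x - f t y‖ ≤ L t * ‖x - y‖)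
    (hint : ∀ y : ℝ → F, Continuous y → IntervalIntegrable (fun s => f s (y s)) volume 0 1)
    (x₀ : F) :
    ∃ y : ℝ → F, Continuous y ∧
      ∀ t ∈ Icc (0 : ℝ) 1, y t = x₀ + ∫ s in (0 : ℝ)..t, f s (y s) := by
  set ℓ : ℝ → ℝ := fun t => ∫ s in (0 : ℝ)..t, L s with hℓ
  have hℓc : Continuous ℓ := continuous_primitive_of_integrable hL
  let ext : C(Icc (0 : ℝ) 1, F) → ℝ → F := fun z s =>
    Real.exp (2 * ℓ s) • z (projIcc 0 1 zero_le_one s)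
  have hext : ∀ z, Continuous (ext z) := fun z => by
    have : Continuous (fun s => z (projIcc (0 : ℝ) 1 zero_le_one s)) :=
      z.continuous.comp continuous_projIcc
    fun_prop
  have hprim : ∀ z, ContinuousOn (fun t => ∫ s in (0 : ℝ)..t, f s (ext z s)) (Icc 0 1) :=
    fun z => by
      have := intervalIntegral.continuousOn_primitive_interval' (hint _ (hext z))
        (left_mem_uIcc)
      rwa [uIcc_of_le zero_le_one] at this
  let S : C(Icc (0 : ℝ) 1, F) → C(Icc (0 : ℝ) 1, F) := fun z =>
    ⟨fun t => Real.exp (-(2 * ℓ t)) • (x₀ + ∫ s in (0 : ℝ)..t, f s (ext z s)), by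
      have h1 := (hprim z).domRestrict
      have h2 : Continuous fun t : Icc (0 : ℝ) 1 => Real.exp (-(2 * ℓ t)) := by fun_prop
      exact h2.smul (continuous_const.add h1)⟩
  have hsub : ∀ t ∈ Icc (0 : ℝ) 1, ∀ z,
      IntervalIntegrable (fun s => f s (ext z s)) volume 0 t := fun t ht z =>
    (hint _ (hext z)).mono_set (by
      rw [uIcc_of_le ht.1, uIcc_of_le zero_le_one]; exact Icc_subset_Icc_right ht.2)
  have hS : ContractingWith (1 / 2) S := by
    refine ⟨by norm_num, LipschitzWith.of_dist_le_mul fun z w => ?_⟩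
    rw [ContinuousMap.dist_le (by positivity)]
    intro t
    have ht := t.2
    have hec : Continuous fun t => Real.exp (2 * ℓ t) := by fun_prop
    have h1 : ‖(∫ s in (0 : ℝ)..t, f s (ext z s)) - ∫ s in (0 : ℝ)..t, f s (ext w s)‖ ≤
        dist z w * (Real.exp (2 * ℓ t) / 2) := by
      rw [← intervalIntegral.integral_sub (hsub t ht z) (hsub t ht w)]
      calc _ ≤ ∫ s in (0 : ℝ)..t, dist z w * (L s * Real.exp (2 * ℓ s)) := by
            refine intervalIntegral.norm_integral_le_of_norm_le ht.1 (ae_of_all _ ?_)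
              ((intervalIntegrable_mul_continuous hL ht.1 hec.continuousOn).const_mul _)
            intro s hs
            have hs' : s ∈ Icc (0 : ℝ) 1 := ⟨hs.1.le, hs.2.trans ht.2⟩
            refine (hLip s hs' _ _).trans ?_
            have h3 : ‖ext z s - ext w s‖ ≤ Real.exp (2 * ℓ s) * dist z w := by
              simp only [ext]
              rw [← smul_sub, norm_smul, Real.norm_of_nonneg (Real.exp_pos _).le, ← dist_eq_norm]
              gcongr
              exact ContinuousMap.dist_apply_le_dist _
            have := mul_le_mul_of_nonneg_left h3 (hL0 s)
            linarith
        _ = dist z w * ∫ s in (0 : ℝ)..t, L s * Real.exp (2 * ℓ s) :=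
            intervalIntegral.integral_const_mul _ _
        _ ≤ _ := mul_le_mul_of_nonneg_left (integral_mul_exp_primitive_le hL hL0 ht.1)
            dist_nonneg
    have h2 : dist (S z t) (S w t) ≤ Real.exp (-(2 * ℓ t)) *
        (dist z w * (Real.exp (2 * ℓ t) / 2)) := by
      simp only [S, ContinuousMap.coe_mk]
      rw [dist_eq_norm, ← smul_sub, norm_smul, Real.norm_of_nonneg (Real.exp_pos _).le,
        add_sub_add_left_eq_sub]
      gcongr
    refine h2.trans (le_of_eq ?_)
    have h3 : Real.exp (-(2 * ℓ t)) * Real.exp (2 * ℓ t) = 1 := by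
      rw [← Real.exp_add, neg_add_cancel, Real.exp_zero]
    push_cast
    linear_combination (dist z w / 2) * h3
  obtain ⟨z, hz⟩ : ∃ z, S z = z := ⟨_, hS.fixedPoint_isFixedPt⟩
  refine ⟨ext z, hext z, fun t ht => ?_⟩
  have h1 : z ⟨t, ht⟩ = Real.exp (-(2 * ℓ t)) • (x₀ + ∫ s in (0 : ℝ)..t, f s (ext z s)) := by
    conv_lhs => rw [← hz]
    rfl
  conv_lhs => simp only [ext]
  rw [projIcc_of_mem zero_le_one ht, h1, smul_smul, ← Real.exp_add, add_neg_cancel, Real.exp_zero,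
    one_smul]

end Caratheodory

/-! ### Vector fields with two bounded derivatives -/

section VectorFields

variable {n : ℕ} {V : Type*} [NormedAddCommGroup V] [InnerProductSpace ℝ V]
  [RKHS ℝ V (Eucl n) (Eucl n)]

/-- The bounds on the fields of `V` and on their derivatives that are used to study flows. -/
structure HasC2Bound (V : Type*) [NormedAddCommGroup V] [InnerProductSpace ℝ V]
    [RKHS ℝ V (Eucl n) (Eucl n)] (C : ℝ) : Prop where
  nonneg : 0 ≤ C
  differentiable : ∀ v : V, Differentiable ℝ v
  norm_apply_le : ∀ (v : V) x, ‖v x‖ ≤ C * ‖v‖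
  norm_fderiv_le : ∀ (v : V) x, ‖fderiv ℝ v x‖ ≤ C * ‖v‖
  norm_fderiv_sub_le : ∀ (v : V) x y, ‖fderiv ℝ v x - fderiv ℝ v y‖ ≤ C * ‖v‖ * ‖x - y‖

lemma EmbedsInC02.hasC2Bound (hV : EmbedsInC02 V) : ∃ C, HasC2Bound V C := by
  obtain ⟨h1, C, hC⟩ := hV
  have hC' : ∀ v : V, ∀ j ≤ 2, ∀ x, ‖iteratedFDeriv ℝ j v x‖ ≤ |C| * ‖v‖ := fun v j hj x =>
    (hC v j hj x).trans (mul_le_mul_of_nonneg_right (le_abs_self C) (norm_nonneg v))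
  refine ⟨|C|, abs_nonneg C, fun v => (h1 v).1.differentiable (by norm_num), fun v x => ?_,
    fun v x => ?_, fun v x y => ?_⟩
  · simpa using hC' v 0 (by norm_num) x
  · have := hC' v 1 (by norm_num) x
    rwa [norm_iteratedFDeriv_one] at this
  · refine convex_univ.norm_image_sub_le_of_norm_fderiv_le (𝕜 := ℝ) (f := fderiv ℝ v) ?_ ?_
      (mem_univ y) (mem_univ x)
    · intro z _
      have : ContDiff ℝ 1 (fderiv ℝ v) := (h1 v).1.fderiv_right (by norm_num)
      exact this.differentiable (by norm_num) z
    · intro z _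
      have := hC' v 2 le_rfl z
      rwa [← norm_iteratedFDeriv_fderiv (n := 1), norm_iteratedFDeriv_one] at this

namespace HasC2Bound

variable {C : ℝ} (hC : HasC2Bound V C)

include hC

lemma norm_apply_sub_le (v : V) (x y : Eucl n) : ‖v x - v y‖ ≤ C * ‖v‖ * ‖x - y‖ :=
  convex_univ.norm_image_sub_le_of_norm_fderiv_le (𝕜 := ℝ)
    (fun z _ => hC.differentiable v z) (fun z _ => hC.norm_fderiv_le v z) (mem_univ y) (mem_univ x)

lemma norm_taylor_le (v : V) (x y : Eucl n) :
    ‖v y - v x - fderiv ℝ v x (y - x)‖ ≤ C * ‖v‖ * ‖y - x‖ ^ 2 := by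
  have h := (convex_segment x y).norm_image_sub_le_of_norm_fderiv_le' (𝕜 := ℝ) (f := v)
    (φ := fderiv ℝ v x) (C := C * ‖v‖ * ‖y - x‖) (fun z _ => hC.differentiable v z) (fun z hz => ?_)
    (left_mem_segment ℝ x y) (right_mem_segment ℝ x y)
  · rwa [mul_assoc, ← sq] at h
  · refine (hC.norm_fderiv_sub_le v z x).trans ?_
    have := norm_nonneg v
    have := hC.nonneg
    have hzx : ‖z - x‖ ≤ ‖y - x‖ := by
      obtain ⟨θ, ⟨hθ0, hθ1⟩, rfl⟩ := (segment_eq_image' ℝ x y ▸ hz)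
      rw [add_sub_cancel_left, norm_smul, Real.norm_of_nonneg hθ0]
      exact mul_le_of_le_one_left (norm_nonneg _) hθ1
    gcongr

lemma continuous_apply : Continuous fun p : V × Eucl n => p.1 p.2 := by
  rw [continuous_iff_continuousAt]
  rintro ⟨v, x⟩
  rw [ContinuousAt, tendsto_iff_norm_sub_tendsto_zero]
  have hlim : Tendsto (fun p : V × Eucl n => C * ‖p.1 - v‖ + C * ‖v‖ * ‖p.2 - x‖)
      (𝓝 (v, x)) (𝓝 (C * ‖v - v‖ + C * ‖v‖ * ‖x - x‖)) := Continuous.tendsto (by fun_prop) _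
  simp only [sub_self, norm_zero, mul_zero, add_zero] at hlim
  refine squeeze_zero (fun _ => norm_nonneg _) (fun p => ?_) hlim
  have h1 := hC.norm_apply_le (p.1 - v) p.2
  have h2 := hC.norm_apply_sub_le v p.2 x
  calc ‖p.1 p.2 - v x‖ = ‖(p.1 - v) p.2 + (v p.2 - v x)‖ := by simp
    _ ≤ _ := (norm_add_le _ _).trans (add_le_add h1 h2)

lemma continuous_fderiv_apply : Continuous fun p : V × Eucl n => fderiv ℝ p.1 p.2 := by
  rw [continuous_iff_continuousAt]
  rintro ⟨v, x⟩
  rw [ContinuousAt, tendsto_iff_norm_sub_tendsto_zero]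
  have hlim : Tendsto (fun p : V × Eucl n => C * ‖p.1 - v‖ + C * ‖v‖ * ‖p.2 - x‖)
      (𝓝 (v, x)) (𝓝 (C * ‖v - v‖ + C * ‖v‖ * ‖x - x‖)) := Continuous.tendsto (by fun_prop) _
  simp only [sub_self, norm_zero, mul_zero, add_zero] at hlim
  refine squeeze_zero (fun _ => norm_nonneg _) (fun p => ?_) hlim
  have h1 := hC.norm_fderiv_le (p.1 - v) p.2
  have h2 := hC.norm_fderiv_sub_le v p.2 x
  have h3 : fderiv ℝ (p.1 - v : V) p.2 = fderiv ℝ p.1 p.2 - fderiv ℝ v p.2 := by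
    rw [RKHS.coe_sub, fderiv_sub (hC.differentiable p.1 p.2) (hC.differentiable v p.2)]
  calc ‖fderiv ℝ p.1 p.2 - fderiv ℝ v x‖
      = ‖fderiv ℝ (p.1 - v : V) p.2 + (fderiv ℝ v p.2 - fderiv ℝ v x)‖ := by rw [h3]; simp
    _ ≤ _ := (norm_add_le _ _).trans (add_le_add h1 h2)

end HasC2Bound

end VectorFields

/-! ### Square integrable paths -/

section Paths

variable {V : Type*} [NormedAddCommGroup V]

lemma L2Path.memLp (v : L2Path V) : MemLp v 2 ((volume : Measure ℝ).restrict (Icc 0 1)) :=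
  Lp.memLp v

lemma L2Path.integrableOn_norm (v : L2Path V) : IntegrableOn (fun t => ‖v t‖) (Icc 0 1) :=
  ((L2Path.memLp v).integrable (by norm_num)).norm

lemma L2Path.integrableOn_norm_sq (v : L2Path V) :
    IntegrableOn (fun t => ‖v t‖ ^ 2) (Icc 0 1) :=
  (L2Path.memLp v).integrable_norm_pow (by norm_num)

lemma L2Path.integral_norm_sq [InnerProductSpace ℝ V] (v : L2Path V) :
    ∫ t in Icc (0 : ℝ) 1, ‖v t‖ ^ 2 = ‖v‖ ^ 2 := by
  rw [← real_inner_self_eq_norm_sq, L2.inner_def]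
  simp

/-- The function `t ↦ C ‖v t‖` on `[0,1]`, extended by zero. It bounds the Lipschitz constant of the
field at time `t`. -/
noncomputable def speedBound (C : ℝ) (v : L2Path V) : ℝ → ℝ :=
  (Icc (0 : ℝ) 1).indicator fun t => C * ‖v t‖

lemma speedBound_of_mem (C : ℝ) (v : L2Path V) {t : ℝ} (ht : t ∈ Icc (0 : ℝ) 1) :
    speedBound C v t = C * ‖v t‖ := indicator_of_mem ht _

lemma integrable_speedBound (C : ℝ) (v : L2Path V) : Integrable (speedBound C v) :=
  (integrable_indicator_iff measurableSet_Icc).2 ((L2Path.integrableOn_norm v).const_mul C)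

lemma speedBound_nonneg {C : ℝ} (hC : 0 ≤ C) (v : L2Path V) (t : ℝ) : 0 ≤ speedBound C v t :=
  indicator_nonneg (fun _ _ => mul_nonneg hC (norm_nonneg _)) t

lemma integral_uIoc_norm_le [InnerProductSpace ℝ V] (v : L2Path V) {s t η : ℝ}
    (hs : s ∈ Icc (0 : ℝ) 1)
    (ht : t ∈ Icc (0 : ℝ) 1) (hη : 0 < η) :
    ∫ r in uIoc s t, ‖v r‖ ≤ η * ‖v‖ ^ 2 + |t - s| / (4 * η) := by
  have hsub : uIoc s t ⊆ Icc 0 1 :=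
    uIoc_subset_uIcc.trans (OrdConnected.uIcc_subset inferInstance hs ht)
  have h1 := (L2Path.integrableOn_norm v).mono_set hsub
  have h2 := (L2Path.integrableOn_norm_sq v).mono_set hsub
  have h3 : IntegrableOn (fun _ : ℝ => 1 / (4 * η)) (uIoc s t) := by
    refine integrableOn_const ?_
    simp [Real.volume_uIoc]
  calc ∫ r in uIoc s t, ‖v r‖ ≤ ∫ r in uIoc s t, (η * ‖v r‖ ^ 2 + 1 / (4 * η)) := by
        refine integral_mono h1 ((h2.const_mul η).add h3) fun r => ?_
        have : 0 ≤ η * (‖v r‖ - 1 / (2 * η)) ^ 2 := by positivity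
        have h4 : η * (‖v r‖ - 1 / (2 * η)) ^ 2 = η * ‖v r‖ ^ 2 + 1 / (4 * η) - ‖v r‖ := by
          field_simp; ring
        simp only
        linarith
    _ = η * (∫ r in uIoc s t, ‖v r‖ ^ 2) + |t - s| / (4 * η) := by
        rw [integral_add (h2.const_mul η) h3, integral_const_mul, setIntegral_const,
          Measure.real, Real.volume_uIoc, ENNReal.toReal_ofReal (abs_nonneg _)]
        simp [div_eq_mul_inv]
    _ ≤ _ := by
        rw [← L2Path.integral_norm_sq v]
        gcongr
        exact Eventually.of_forall fun _ => sq_nonneg _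
        exact L2Path.integrableOn_norm_sq v

lemma integral_speedBound_le [InnerProductSpace ℝ V] {C R : ℝ} (hC : 0 ≤ C) {v : L2Path V}
    (hv : ‖v‖ ≤ R) :
    ∫ t in (0 : ℝ)..1, speedBound C v t ≤ C * (R ^ 2 + 1) := by
  have h1 : ∫ t in (0 : ℝ)..1, speedBound C v t = C * ∫ t in uIoc (0 : ℝ) 1, ‖v t‖ := by
    rw [uIoc_of_le zero_le_one, intervalIntegral.integral_of_le zero_le_one, ← integral_const_mul]
    refine setIntegral_congr_fun measurableSet_Ioc fun t ht => ?_
    exact speedBound_of_mem C v ⟨ht.1.le, ht.2⟩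
  rw [h1]
  have h2 := integral_uIoc_norm_le v (s := 0) (t := 1) (by simp) (by simp) one_pos
  have h3 : ‖v‖ ^ 2 ≤ R ^ 2 := pow_le_pow_left₀ (norm_nonneg v) hv 2
  refine mul_le_mul_of_nonneg_left ?_ hC
  norm_num [uIoc_of_le] at h2 ⊢
  linarith

end Paths

/-- A version of Gronwall's inequality for `y t = r t + ∫₀ᵗ g` with `|g| ≤ L (|y| + b)`. -/
lemma gronwall_norm {F : Type*} [NormedAddCommGroup F] [NormedSpace ℝ F] {L : ℝ → ℝ}
    (hL : Integrable L) (hL0 : ∀ t, 0 ≤ L t) {Λ : ℝ} (hΛ : ∫ s in (0 : ℝ)..1, L s ≤ Λ)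
    {y r g : ℝ → F} {a b : ℝ}
    (ha : 0 ≤ a) (hb : 0 ≤ b) (hy : ContinuousOn y (Icc 0 1))
    (hr : ∀ t ∈ Icc (0 : ℝ) 1, ‖r t‖ ≤ a)
    (hg : ∀ t ∈ Icc (0 : ℝ) 1, ‖g t‖ ≤ L t * (‖y t‖ + b))
    (heq : ∀ t ∈ Icc (0 : ℝ) 1, y t = r t + ∫ s in (0 : ℝ)..t, g s) :
    ∀ t ∈ Icc (0 : ℝ) 1, ‖y t‖ ≤ 2 * (a + b * Λ) * Real.exp (2 * Λ) := by
  have hΛ0 : 0 ≤ Λ := (primitive_nonneg hL0 zero_le_one).trans hΛ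
  have key := gronwall_integral hL hL0 (u := fun t => ‖y t‖) (a := a + b * Λ) (by positivity)
    hy.norm (fun _ _ => norm_nonneg _) ?_
  · intro t ht
    refine (key t ht).trans ?_
    gcongr
  intro t ht
  have hyt : ContinuousOn (fun s => ‖y s‖) (Icc 0 t) :=
    hy.norm.mono (Icc_subset_Icc_right ht.2)
  have h1 := intervalIntegrable_mul_continuous hL ht.1 hyt
  have h2 : IntervalIntegrable (fun s => L s * b) volume 0 t :=
    hL.intervalIntegrable.mul_const b
  have h3 : ‖∫ s in (0 : ℝ)..t, g s‖ ≤ ∫ s in (0 : ℝ)..t, (L s * ‖y s‖ + L s * b) := by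
    refine intervalIntegral.norm_integral_le_of_norm_le ht.1 (ae_of_all _ fun s hs => ?_)
      (h1.add h2)
    rw [← mul_add]
    exact hg s ⟨hs.1.le, hs.2.trans ht.2⟩
  rw [intervalIntegral.integral_add h1 h2, intervalIntegral.integral_mul_const] at h3
  have h4 : ∫ s in (0 : ℝ)..t, L s ≤ Λ :=
    (monotoneOn_primitive hL hL0 (mem_Ici.2 ht.1) (mem_Ici.2 zero_le_one) ht.2).trans hΛ
  have h5 := mul_le_mul_of_nonneg_right h4 hb
  have h6 := norm_add_le (r t) (∫ s in (0 : ℝ)..t, g s)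
  rw [← heq t ht] at h6
  have h7 := hr t ht
  linarith

/-! ### Flows -/

section Flows

variable {n : ℕ} {V : Type*} [NormedAddCommGroup V] [InnerProductSpace ℝ V]
  [RKHS ℝ V (Eucl n) (Eucl n)] {C : ℝ}

/-- A Lipschitz constant of the time-one flows of the paths of norm at most `R`. -/
noncomputable def flowLip (C R : ℝ) : ℝ := 2 * Real.exp (2 * (C * (R ^ 2 + 1)))

lemma flowLip_nonneg (C R : ℝ) : 0 ≤ flowLip C R := by unfold flowLip; positivity

/-- A bound on the second order Taylor remainder of the time-one flows of the paths of norm at most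
`R`. -/
noncomputable def flowTaylor (C R : ℝ) : ℝ :=
  flowLip C R ^ 2 * (C * (R ^ 2 + 1)) * flowLip C R

namespace HasC2Bound

variable (hC : HasC2Bound V C)

include hC

lemma intervalIntegrable_apply (v : L2Path V) {y : ℝ → Eucl n} (hy : ContinuousOn y (Icc 0 1))
    {s t : ℝ} (hs : s ∈ Icc (0 : ℝ) 1) (ht : t ∈ Icc (0 : ℝ) 1) :
    IntervalIntegrable (fun r => v r (y r)) volume s t := by
  have h : IntegrableOn (fun r => v r (y r)) (Icc 0 1) := by
    refine ((L2Path.integrableOn_norm v).const_mul C).mono' ?_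
      (Eventually.of_forall fun r => hC.norm_apply_le (v r) (y r))
    exact hC.continuous_apply.comp_aestronglyMeasurable
      ((L2Path.memLp v).1.prodMk (hy.aestronglyMeasurable measurableSet_Icc))
  exact (h.mono_set (OrdConnected.uIcc_subset inferInstance hs ht)).intervalIntegrable

lemma intervalIntegrable_fderiv_comp (v : L2Path V) {y : ℝ → Eucl n}
    (hy : ContinuousOn y (Icc 0 1)) {A : ℝ → Eucl n →L[ℝ] Eucl n} (hA : ContinuousOn A (Icc 0 1))
    {t : ℝ} (ht : t ∈ Icc (0 : ℝ) 1) :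
    IntervalIntegrable (fun r => (fderiv ℝ (v r) (y r)).comp (A r)) volume 0 t := by
  have hD : IntegrableOn (fun r => fderiv ℝ (v r) (y r)) (Icc 0 1) := by
    refine ((L2Path.integrableOn_norm v).const_mul C).mono' ?_
      (Eventually.of_forall fun r => hC.norm_fderiv_le (v r) (y r))
    exact hC.continuous_fderiv_apply.comp_aestronglyMeasurable
      ((L2Path.memLp v).1.prodMk (hy.aestronglyMeasurable measurableSet_Icc))
  obtain ⟨M, hM⟩ := isCompact_Icc.exists_bound_of_continuousOn hA
  have h : IntegrableOn (fun r => (fderiv ℝ (v r) (y r)).comp (A r)) (Icc 0 1) := by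
    refine (hD.norm.mul_const M).mono' ?_ ?_
    · exact (ContinuousLinearMap.compL ℝ (Eucl n) (Eucl n) (Eucl n)).aestronglyMeasurable_comp₂
        hD.1 (hA.aestronglyMeasurable measurableSet_Icc)
    · filter_upwards [ae_restrict_mem measurableSet_Icc] with r hr
      exact (ContinuousLinearMap.opNorm_comp_le _ _).trans
        (mul_le_mul_of_nonneg_left (hM r hr) (norm_nonneg _))
  exact (h.mono_set (OrdConnected.uIcc_subset inferInstance (by simp) ht)).intervalIntegrable

/-- A square integrable path of vector fields has a flow. -/
lemma exists_isFlow (v : L2Path V) : ∃ φ, IsFlow (v : ℝ → V) φ := by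
  have h : ∀ x : Eucl n, ∃ y : ℝ → Eucl n, Continuous y ∧
      ∀ t ∈ Icc (0 : ℝ) 1, y t = x + ∫ s in (0 : ℝ)..t, v s (y s) := fun x => by
    refine exists_integral_equation_solution (integrable_speedBound C v)
      (speedBound_nonneg hC.nonneg v) (fun t x => v t x) (fun t ht x y => ?_) (fun y hy => ?_) x
    · rw [speedBound_of_mem C v ht]
      exact hC.norm_apply_sub_le (v t) x y
    · exact hC.intervalIntegrable_apply v hy.continuousOn (by simp) (by simp)
  choose y hy heq using h
  refine ⟨fun t x => y x t, fun x => ⟨(hy x).continuousOn, fun t ht => ⟨?_, heq x t ht⟩⟩⟩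
  exact hC.intervalIntegrable_apply v (hy x).continuousOn (by simp) ht

lemma isFlow_flow (v : L2Path V) : IsFlow (v : ℝ → V) (flow v) :=
  Classical.epsilon_spec (hC.exists_isFlow v)

lemma norm_flow_sub_le {R : ℝ} {v : L2Path V} (hv : ‖v‖ ≤ R) (x y : Eucl n) {t : ℝ}
    (ht : t ∈ Icc (0 : ℝ) 1) :
    ‖flow v t x - flow v t y‖ ≤ flowLip C R * ‖x - y‖ := by
  have hφ := hC.isFlow_flow v
  have h := gronwall_norm (integrable_speedBound C v) (speedBound_nonneg hC.nonneg v)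
    (integral_speedBound_le hC.nonneg hv) (y := fun t => flow v t x - flow v t y)
    (r := fun _ => x - y) (g := fun s => v s (flow v s x) - v s (flow v s y))
    (norm_nonneg (x - y)) le_rfl ((hφ x).1.sub (hφ y).1) (fun _ _ => le_rfl) (fun s hs => ?_)
    (fun s hs => ?_) t ht
  · refine h.trans (le_of_eq ?_)
    rw [flowLip]
    ring
  · rw [speedBound_of_mem C v hs, add_zero]
    exact hC.norm_apply_sub_le _ _ _
  · obtain ⟨h1, h2⟩ := (hφ x).2 s hs
    obtain ⟨h3, h4⟩ := (hφ y).2 s hs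
    rw [intervalIntegral.integral_sub h1 h3]
    conv_lhs => rw [h2, h4]
    abel

lemma flowTaylor_nonneg (R : ℝ) : 0 ≤ flowTaylor C R := by
  have := flowLip_nonneg C R
  have := hC.nonneg
  unfold flowTaylor
  positivity

lemma exists_linear_approx_flow {R : ℝ} {v : L2Path V} (hv : ‖v‖ ≤ R) (x : Eucl n) :
    ∃ A : Eucl n →L[ℝ] Eucl n, ∀ h, ‖flow v 1 (x + h) - flow v 1 x - A h‖ ≤
      flowTaylor C R * ‖h‖ ^ 2 := by
  have hφ := hC.isFlow_flow v
  obtain ⟨A, hAc, hA⟩ := exists_integral_equation_solution (integrable_speedBound C v)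
    (speedBound_nonneg hC.nonneg v)
    (fun t (B : Eucl n →L[ℝ] Eucl n) => (fderiv ℝ (v t) (flow v t x)).comp B)
    (fun t ht B B' => by
      rw [speedBound_of_mem C v ht, ← ContinuousLinearMap.comp_sub]
      exact (ContinuousLinearMap.opNorm_comp_le _ _).trans
        (mul_le_mul_of_nonneg_right (hC.norm_fderiv_le _ _) (norm_nonneg _)))
    (fun B hB => hC.intervalIntegrable_fderiv_comp v (hφ x).1 hB.continuousOn (by simp))
    (ContinuousLinearMap.id ℝ (Eucl n))
  refine ⟨A 1, fun h => ?_⟩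
  have key := gronwall_norm (integrable_speedBound C v) (speedBound_nonneg hC.nonneg v)
    (integral_speedBound_le hC.nonneg hv)
    (y := fun t => flow v t (x + h) - flow v t x - A t h)
    (r := fun _ => 0) (b := (flowLip C R * ‖h‖) ^ 2)
    (g := fun s => v s (flow v s (x + h)) - v s (flow v s x) -
      (fderiv ℝ (v s) (flow v s x)).comp (A s) h)
    le_rfl (by positivity)
    (((hφ (x + h)).1.sub (hφ x).1).sub (hAc.clm_apply continuous_const).continuousOn)
    (fun _ _ => by simp) (fun s hs => ?_) (fun s hs => ?_) 1 (by simp)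
  · refine key.trans (le_of_eq ?_)
    rw [flowTaylor]
    nth_rewrite 3 [flowLip]
    ring
  · rw [speedBound_of_mem C v hs]
    set D := fderiv ℝ (v s) (flow v s x)
    have h1 : v s (flow v s (x + h)) - v s (flow v s x) - D.comp (A s) h =
        (v s (flow v s (x + h)) - v s (flow v s x) - D (flow v s (x + h) - flow v s x)) +
          D (flow v s (x + h) - flow v s x - A s h) := by
      simp only [ContinuousLinearMap.comp_apply, map_sub]
      abel
    have h2 := hC.norm_taylor_le (v s) (flow v s x) (flow v s (x + h))
    have h3 := D.le_of_opNorm_le (hC.norm_fderiv_le (v s) (flow v s x))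
      (flow v s (x + h) - flow v s x - A s h)
    have h4 := hC.norm_flow_sub_le hv (x + h) x hs
    rw [add_sub_cancel_left] at h4
    have h5 : C * ‖v s‖ * ‖flow v s (x + h) - flow v s x‖ ^ 2 ≤
        C * ‖v s‖ * (flowLip C R * ‖h‖) ^ 2 := by
      have := hC.nonneg
      gcongr
    rw [h1, mul_add]
    exact (norm_add_le _ _).trans (by linarith)
  · obtain ⟨h1, h2⟩ := (hφ (x + h)).2 s hs
    obtain ⟨h3, h4⟩ := (hφ x).2 s hs
    have h5 := hC.intervalIntegrable_fderiv_comp v (hφ x).1 hAc.continuousOn hs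
    have h6 : A s h = h + ∫ r in (0 : ℝ)..s, (fderiv ℝ (v r) (flow v r x)).comp (A r) h := by
      conv_lhs => rw [hA s hs]
      rw [add_apply, ContinuousLinearMap.intervalIntegral_apply h5]
      rfl
    have h7 : IntervalIntegrable (fun r => (fderiv ℝ (v r) (flow v r x)).comp (A r) h)
        volume 0 s :=
      ⟨h5.1.apply_continuousLinearMap h, h5.2.apply_continuousLinearMap h⟩
    rw [intervalIntegral.integral_sub (h1.sub h3) h7, intervalIntegral.integral_sub h1 h3]
    conv_lhs => rw [h2, h4, h6]
    abel

end HasC2Bound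

lemma hasFDerivAt_of_norm_le_sq {E F : Type*} [NormedAddCommGroup E] [NormedSpace ℝ E]
    [NormedAddCommGroup F] [NormedSpace ℝ F] {f : E → F} {A : E →L[ℝ] F} {x : E} {M : ℝ}
    (h : ∀ k, ‖f (x + k) - f x - A k‖ ≤ M * ‖k‖ ^ 2) : HasFDerivAt f A x := by
  rw [hasFDerivAt_iff_isLittleO_nhds_zero]
  refine Asymptotics.IsBigO.trans_isLittleO (g := fun k : E => ‖k‖ ^ 2)
    (Asymptotics.IsBigO.of_bound M (Eventually.of_forall fun k => ?_)) ?_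
  · simpa using h k
  · have := Asymptotics.isLittleO_norm_pow_id (E' := E) (one_lt_two)
    simpa using this

lemma HasC2Bound.norm_flow_taylor_le (hC : HasC2Bound V C) {R : ℝ} {v : L2Path V} (hv : ‖v‖ ≤ R)
    (x h : Eucl n) :
    ‖flow v 1 (x + h) - flow v 1 x - fderiv ℝ (flow v 1) x h‖ ≤ flowTaylor C R * ‖h‖ ^ 2 := by
  obtain ⟨A, hA⟩ := hC.exists_linear_approx_flow hv x
  rw [(hasFDerivAt_of_norm_le_sq hA).fderiv]
  exact hA h

end Flows

/-! ### Convergence of flows along weakly convergent paths -/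

lemma tendsto_of_tendsto_inner {E : Type*} [NormedAddCommGroup E] [InnerProductSpace ℝ E]
    [FiniteDimensional ℝ E] {ι : Type*} {l : Filter ι} {u : ι → E} {a : E}
    (h : ∀ e, Tendsto (fun i => inner ℝ (u i) e) l (𝓝 (inner ℝ a e))) : Tendsto u l (𝓝 a) := by
  set b := stdOrthonormalBasis ℝ E
  have h1 : ∀ x : E, x = ∑ j, inner ℝ x (b j) • b j := fun x => by
    conv_lhs => rw [← b.sum_repr' x]
    simp_rw [real_inner_comm]
  rw [h1 a, show u = fun i => ∑ j, inner ℝ (u i) (b j) • b j from funext fun i => h1 (u i)]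
  exact tendsto_finsetSum _ fun j _ => (h (b j)).smul_const _

lemma tendsto_clm_of_tendsto_apply {E F : Type*} [NormedAddCommGroup E] [NormedSpace ℝ E]
    [FiniteDimensional ℝ E] [NormedAddCommGroup F] [NormedSpace ℝ F] {ι : Type*} {l : Filter ι}
    {A : ι → E →L[ℝ] F} {B : E →L[ℝ] F} (h : ∀ x, Tendsto (fun i => A i x) l (𝓝 (B x))) :
    Tendsto A l (𝓝 B) := by
  let e : (E →L[ℝ] F) ≃L[ℝ] Fin (Module.finrank ℝ E) → F :=
    ((ContinuousLinearEquiv.ofFinrankEq (Module.finrank_fin_fun ℝ).symm).arrowCongr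
      (1 : F ≃L[ℝ] F)).trans (ContinuousLinearEquiv.piRing _)
  rw [e.toHomeomorph.isInducing.tendsto_nhds_iff]
  exact tendsto_pi_nhds.2 fun i => h _

section WeakFlows

variable {n : ℕ} {V : Type*} [NormedAddCommGroup V] [InnerProductSpace ℝ V]
  [RKHS ℝ V (Eucl n) (Eucl n)] {C : ℝ}

namespace HasC2Bound

variable (hC : HasC2Bound V C)

include hC

lemma continuous_kerFun [CompleteSpace V] (e : Eucl n) :
    Continuous fun x => RKHS.kerFun V x e := by
  refine LipschitzWith.continuous (K := Real.toNNReal (C * ‖e‖))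
    (LipschitzWith.of_dist_le_mul fun x y => ?_)
  rw [Real.coe_toNNReal _ (mul_nonneg hC.nonneg (norm_nonneg e)), dist_eq_norm, dist_eq_norm]
  set w := RKHS.kerFun V x e - RKHS.kerFun V y e with hw
  have h1 : ‖w‖ * ‖w‖ ≤ (C * ‖e‖ * ‖x - y‖) * ‖w‖ := by
    calc ‖w‖ * ‖w‖ = inner ℝ w w := (real_inner_self_eq_norm_mul_norm w).symm
      _ = inner ℝ (w x - w y) e := by
        conv_lhs => rw [hw, inner_sub_right, ← hw]
        rw [RKHS.inner_kerFun, RKHS.inner_kerFun, inner_sub_left]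
      _ ≤ ‖w x - w y‖ * ‖e‖ := real_inner_le_norm _ _
      _ ≤ C * ‖w‖ * ‖x - y‖ * ‖e‖ :=
        mul_le_mul_of_nonneg_right (hC.norm_apply_sub_le w x y) (norm_nonneg e)
      _ = _ := by ring
  rcases (norm_nonneg w).eq_or_lt with h0 | h0
  · rw [← h0]
    have := hC.nonneg
    positivity
  · exact le_of_mul_le_mul_right h1 h0

variable {ι : Type*} {l : Filter ι} {v : ι → L2Path V} {vbar : L2Path V}

lemma tendsto_integral_apply [CompleteSpace V]
    (hw : ∀ g, Tendsto (fun i => inner ℝ (v i) g) l (𝓝 (inner ℝ vbar g)))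
    {y : ℝ → Eucl n} (hy : ContinuousOn y (Icc 0 1)) {t : ℝ} (ht : t ∈ Icc (0 : ℝ) 1) :
    Tendsto (fun i => ∫ s in (0 : ℝ)..t, v i s (y s)) l
      (𝓝 (∫ s in (0 : ℝ)..t, vbar s (y s))) := by
  refine tendsto_of_tendsto_inner fun e => ?_
  have hk : ContinuousOn (fun s => RKHS.kerFun V (y s) e) (Icc 0 1) :=
    (hC.continuous_kerFun e).comp_continuousOn hy
  obtain ⟨M, hM⟩ := isCompact_Icc.exists_bound_of_continuousOn hk
  have hmem : MemLp (fun s => RKHS.kerFun V (y s) e) 2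
      ((volume : Measure ℝ).restrict (Icc 0 1)) :=
    MemLp.of_bound (hk.aestronglyMeasurable measurableSet_Icc) M
      ((ae_restrict_mem measurableSet_Icc).mono hM)
  have hmem' := hmem.indicator (measurableSet_Ioc (a := (0 : ℝ)) (b := t))
  have hsub : Ioc 0 t ⊆ Icc (0 : ℝ) 1 := fun s hs => ⟨hs.1.le, hs.2.trans ht.2⟩
  have key : ∀ u : L2Path V, inner ℝ u (hmem'.toLp _) =
      inner ℝ (∫ s in (0 : ℝ)..t, u s (y s)) e := fun u => by
    have hint := (hC.intervalIntegrable_apply u hy (s := 0) (by simp) ht).1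
    rw [real_inner_comm e, intervalIntegral.integral_of_le ht.1,
      ← integral_inner hint, L2.inner_def]
    calc _ = ∫ s in Icc (0 : ℝ) 1, (Ioc 0 t).indicator (fun s => inner ℝ e (u s (y s))) s := by
          refine integral_congr_ae ?_
          filter_upwards [hmem'.coeFn_toLp] with s hs
          rw [hs]
          by_cases hst : s ∈ Ioc 0 t
          · simp [hst, real_inner_comm e]
          · simp [hst]
      _ = _ := by
          rw [setIntegral_indicator measurableSet_Ioc, inter_eq_self_of_subset_right hsub]
  simp_rw [← key]
  exact hw _

lemma norm_integral_apply_sub_le {R : ℝ} {u : L2Path V} (hu : ‖u‖ ≤ R) {y : ℝ → Eucl n}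
    (hy : ContinuousOn y (Icc 0 1)) {s t η : ℝ} (hs : s ∈ Icc (0 : ℝ) 1)
    (ht : t ∈ Icc (0 : ℝ) 1) (hη : 0 < η) :
    ‖(∫ r in (0 : ℝ)..t, u r (y r)) - ∫ r in (0 : ℝ)..s, u r (y r)‖ ≤
      C * (η * R ^ 2 + |t - s| / (4 * η)) := by
  rw [intervalIntegral.integral_interval_sub_left
    (hC.intervalIntegrable_apply u hy (by simp) ht)
    (hC.intervalIntegrable_apply u hy (by simp) hs)]
  have hsub : uIoc s t ⊆ Icc 0 1 :=
    uIoc_subset_uIcc.trans (OrdConnected.uIcc_subset inferInstance hs ht)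
  have h1 := integral_uIoc_norm_le u hs ht hη
  have h2 : ‖u‖ ^ 2 ≤ R ^ 2 := pow_le_pow_left₀ (norm_nonneg u) hu 2
  calc _ ≤ ∫ r in uIoc s t, ‖u r (y r)‖ := intervalIntegral.norm_integral_le_integral_norm_uIoc
    _ ≤ ∫ r in uIoc s t, C * ‖u r‖ := by
        refine integral_mono_of_nonneg (Eventually.of_forall fun _ => norm_nonneg _)
          (((L2Path.integrableOn_norm u).mono_set hsub).const_mul C)
          (Eventually.of_forall fun r => hC.norm_apply_le _ _)
    _ = C * ∫ r in uIoc s t, ‖u r‖ := integral_const_mul _ _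
    _ ≤ _ := by
        refine mul_le_mul_of_nonneg_left (h1.trans ?_) hC.nonneg
        gcongr

lemma eventually_norm_integral_apply_sub_le [CompleteSpace V] {R : ℝ}
    (hR : ∀ᶠ i in l, ‖v i‖ ≤ R) (hR' : ‖vbar‖ ≤ R)
    (hw : ∀ g, Tendsto (fun i => inner ℝ (v i) g) l (𝓝 (inner ℝ vbar g)))
    {y : ℝ → Eucl n} (hy : ContinuousOn y (Icc 0 1)) {ε : ℝ} (hε : 0 < ε) :
    ∀ᶠ i in l, ∀ t ∈ Icc (0 : ℝ) 1,
      ‖(∫ s in (0 : ℝ)..t, v i s (y s)) - ∫ s in (0 : ℝ)..t, vbar s (y s)‖ ≤ ε := by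
  have hC0 := hC.nonneg
  obtain ⟨η, hη, hη1⟩ : ∃ η : ℝ, 0 < η ∧ C * (η * R ^ 2) ≤ ε / 6 := by
    refine ⟨ε / (6 * (C * R ^ 2 + 1)), by positivity, ?_⟩
    rw [show C * (ε / (6 * (C * R ^ 2 + 1)) * R ^ 2) =
      ε / 6 * ((C * R ^ 2) / (C * R ^ 2 + 1)) by field_simp]
    refine mul_le_of_le_one_right (by positivity) ?_
    rw [div_le_one (by positivity)]
    linarith
  refine isCompact_Icc.induction_on (p := fun S => ∀ᶠ i in l, ∀ t ∈ S ∩ Icc (0 : ℝ) 1,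
      ‖(∫ s in (0 : ℝ)..t, v i s (y s)) - ∫ s in (0 : ℝ)..t, vbar s (y s)‖ ≤ ε) ?_ ?_ ?_ ?_ |>.mono
    fun i hi t ht => hi t ⟨ht, ht⟩
  · simp
  · exact fun S S' hS h => h.mono fun i hi t ht => hi t ⟨hS ht.1, ht.2⟩
  · intro S S' h h'
    filter_upwards [h, h'] with i hi hi' t ht
    exact ht.1.elim (fun h => hi t ⟨h, ht.2⟩) (fun h => hi' t ⟨h, ht.2⟩)
  · intro t₀ ht₀
    have hc : Tendsto (fun t : ℝ => C * (η * R ^ 2 + |t - t₀| / (4 * η))) (𝓝 t₀)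
        (𝓝 (C * (η * R ^ 2 + |t₀ - t₀| / (4 * η)))) := Continuous.tendsto (by fun_prop) _
    rw [sub_self, abs_zero, zero_div, add_zero] at hc
    have hU := hc.eventually_lt_const (lt_of_le_of_lt hη1 (by linarith : ε / 6 < ε / 3))
    refine ⟨_, mem_nhdsWithin_of_mem_nhds hU, ?_⟩
    have hpt := (tendsto_iff_norm_sub_tendsto_zero.1
      (hC.tendsto_integral_apply hw hy ht₀)).eventually_lt_const (by positivity : 0 < ε / 3)
    filter_upwards [hR, hpt] with i hi hi' t ht
    have h1 := hC.norm_integral_apply_sub_le hi hy ht₀ ht.2 hη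
    have h2 := hC.norm_integral_apply_sub_le hR' hy ht₀ ht.2 hη
    have h3 : C * (η * R ^ 2 + |t - t₀| / (4 * η)) < ε / 3 := ht.1
    set a := ∫ s in (0 : ℝ)..t, v i s (y s)
    set b := ∫ s in (0 : ℝ)..t, vbar s (y s)
    set a₀ := ∫ s in (0 : ℝ)..t₀, v i s (y s)
    set b₀ := ∫ s in (0 : ℝ)..t₀, vbar s (y s)
    have h4 : a - b = (a - a₀) + (a₀ - b₀) - (b - b₀) := by abel
    rw [h4]
    have h5 := norm_sub_le (a - a₀ + (a₀ - b₀)) (b - b₀)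
    have h6 := norm_add_le (a - a₀) (a₀ - b₀)
    linarith

lemma tendsto_flow_apply [CompleteSpace V] {R : ℝ} (hR : ∀ᶠ i in l, ‖v i‖ ≤ R) (hR' : ‖vbar‖ ≤ R)
    (hw : ∀ g, Tendsto (fun i => inner ℝ (v i) g) l (𝓝 (inner ℝ vbar g))) (x : Eucl n) :
    Tendsto (fun i => flow (v i) 1 x) l (𝓝 (flow vbar 1 x)) := by
  have hφ := hC.isFlow_flow vbar
  rw [tendsto_iff_norm_sub_tendsto_zero, Metric.tendsto_nhds]
  intro ε hε
  have hB : 0 < flowLip C R + 1 := by linarith [flowLip_nonneg C R]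
  filter_upwards [hR, hC.eventually_norm_integral_apply_sub_le hR hR' hw (hφ x).1
    (div_pos hε hB)] with i hi hi'
  have hφi := hC.isFlow_flow (v i)
  have key := gronwall_norm (integrable_speedBound C (v i)) (speedBound_nonneg hC.nonneg (v i))
    (integral_speedBound_le hC.nonneg hi) (y := fun t => flow (v i) t x - flow vbar t x)
    (r := fun t => (∫ s in (0 : ℝ)..t, v i s (flow vbar s x)) -
      ∫ s in (0 : ℝ)..t, vbar s (flow vbar s x))
    (g := fun s => v i s (flow (v i) s x) - v i s (flow vbar s x))
    (div_pos hε hB).le le_rfl ((hφi x).1.sub (hφ x).1) hi' (fun s hs => ?_) (fun t ht => ?_) 1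
    (by simp)
  · rw [Real.dist_0_eq_abs, abs_norm]
    refine key.trans_lt ?_
    rw [zero_mul, add_zero, show 2 * (ε / (flowLip C R + 1)) *
      Real.exp (2 * (C * (R ^ 2 + 1))) = ε * (flowLip C R / (flowLip C R + 1)) by
        rw [flowLip]; ring]
    refine mul_lt_of_lt_one_right hε ?_
    rw [div_lt_one hB]
    linarith
  · rw [speedBound_of_mem C (v i) hs, add_zero]
    exact hC.norm_apply_sub_le _ _ _
  · obtain ⟨h1, h2⟩ := (hφi x).2 t ht
    obtain ⟨h3, h4⟩ := (hφ x).2 t ht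
    have h5 := hC.intervalIntegrable_apply (v i) (hφ x).1 (s := 0) (by simp) ht
    rw [intervalIntegral.integral_sub h1 h5]
    conv_lhs => rw [h2, h4]
    abel

lemma tendsto_flow [CompleteSpace V] {R : ℝ} (hR : ∀ᶠ i in l, ‖v i‖ ≤ R) (hR' : ‖vbar‖ ≤ R)
    (hw : ∀ g, Tendsto (fun i => inner ℝ (v i) g) l (𝓝 (inner ℝ vbar g))) (x : Eucl n) :
    Tendsto (fun q : ι × Eucl n => flow (v q.1) 1 q.2) (l ×ˢ 𝓝 x) (𝓝 (flow vbar 1 x)) := by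
  rw [tendsto_iff_norm_sub_tendsto_zero]
  have h1 := (tendsto_iff_norm_sub_tendsto_zero.1 (hC.tendsto_flow_apply hR hR' hw x)).comp
    (tendsto_fst (f := l) (g := 𝓝 x))
  have h2 : Tendsto (fun z : Eucl n => flowLip C R * ‖z - x‖) (𝓝 x)
      (𝓝 (flowLip C R * ‖x - x‖)) := Continuous.tendsto (by fun_prop) _
  have h3 := (h2.comp (tendsto_snd (f := l) (g := 𝓝 x))).add h1
  simp only [sub_self, norm_zero, mul_zero, add_zero] at h3
  refine squeeze_zero' (Eventually.of_forall fun _ => norm_nonneg _) ?_ h3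
  filter_upwards [tendsto_fst.eventually hR] with q hq
  have h4 := hC.norm_flow_sub_le hq q.2 x (t := 1) (by simp)
  simp only [Function.comp_apply]
  calc ‖flow (v q.1) 1 q.2 - flow vbar 1 x‖ = ‖(flow (v q.1) 1 q.2 - flow (v q.1) 1 x) +
      (flow (v q.1) 1 x - flow vbar 1 x)‖ := by congr 1; abel
    _ ≤ _ := (norm_add_le _ _).trans (add_le_add_left h4 _)

lemma tendsto_fderiv_flow [CompleteSpace V] {R : ℝ} (hR : ∀ᶠ i in l, ‖v i‖ ≤ R)
    (hR' : ‖vbar‖ ≤ R)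
    (hw : ∀ g, Tendsto (fun i => inner ℝ (v i) g) l (𝓝 (inner ℝ vbar g))) (x : Eucl n) :
    Tendsto (fun q : ι × Eucl n => fderiv ℝ (flow (v q.1) 1) q.2) (l ×ˢ 𝓝 x)
      (𝓝 (fderiv ℝ (flow vbar 1) x)) := by
  refine tendsto_clm_of_tendsto_apply fun h => ?_
  rw [tendsto_iff_norm_sub_tendsto_zero, Metric.tendsto_nhds]
  intro ε hε
  set M := flowTaylor C R with hM
  have hM0 : 0 ≤ M := hC.flowTaylor_nonneg R
  obtain ⟨s, hs, hs1⟩ : ∃ s : ℝ, 0 < s ∧ 2 * (M * ‖h‖ ^ 2) * s < ε / 2 := by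
    refine ⟨ε / (4 * (M * ‖h‖ ^ 2 + 1)), by positivity, ?_⟩
    rw [show 2 * (M * ‖h‖ ^ 2) * (ε / (4 * (M * ‖h‖ ^ 2 + 1))) =
      ε / 2 * ((M * ‖h‖ ^ 2) / (M * ‖h‖ ^ 2 + 1)) by field_simp; ring]
    refine mul_lt_of_lt_one_right (by positivity) ?_
    rw [div_lt_one (by positivity)]
    linarith
  have hshift : Tendsto (fun q : ι × Eucl n => (q.1, q.2 + s • h)) (l ×ˢ 𝓝 x)
      (l ×ˢ 𝓝 (x + s • h)) :=
    tendsto_fst.prodMk (tendsto_snd.add_const _)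
  have h1 := tendsto_iff_norm_sub_tendsto_zero.1 ((hC.tendsto_flow hR hR' hw (x + s • h)).comp hshift)
  have h2 := tendsto_iff_norm_sub_tendsto_zero.1 (hC.tendsto_flow hR hR' hw x)
  have hpos : 0 < s * (ε / 4) := by positivity
  filter_upwards [tendsto_fst.eventually hR, h1.eventually_lt_const hpos,
    h2.eventually_lt_const hpos] with q hq hq1 hq2
  rw [Real.dist_0_eq_abs, abs_norm]
  have h3 := hC.norm_flow_taylor_le hq q.2 (s • h)
  have h4 := hC.norm_flow_taylor_le hR' x (s • h)
  rw [norm_smul, Real.norm_of_nonneg hs.le, ← hM, map_smul] at h3 h4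
  simp only [Function.comp_apply] at hq1
  set D := fderiv ℝ (flow (v q.1) 1) q.2 h
  set D' := fderiv ℝ (flow vbar 1) x h
  set a := flow (v q.1) 1 (q.2 + s • h)
  set b := flow vbar 1 (x + s • h)
  set c := flow (v q.1) 1 q.2
  set d := flow vbar 1 x
  have h5 : s • (D - D') = (a - b) - (c - d) - (a - c - s • D) + (b - d - s • D') := by
    rw [smul_sub]; abel
  have h6 : s * ‖D - D'‖ ≤ ‖a - b‖ + ‖c - d‖ + ‖a - c - s • D‖ + ‖b - d - s • D'‖ := by
    rw [← Real.norm_of_nonneg hs.le, ← norm_smul, Real.norm_of_nonneg hs.le, h5]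
    refine (norm_add_le _ _).trans (add_le_add_left ((norm_sub_le _ _).trans
      (add_le_add_left (norm_sub_le _ _) _)) _)
  have h7 : s * ‖D - D'‖ < s * ε := by nlinarith
  exact lt_of_mul_lt_mul_left h7 hs.le

lemma differentiable_flow (v : L2Path V) : Differentiable ℝ (flow v 1) := fun x => by
  obtain ⟨A, hA⟩ := hC.exists_linear_approx_flow le_rfl x
  exact (hasFDerivAt_of_norm_le_sq hA).differentiableAt

end HasC2Bound

end WeakFlows

/-! ### Topology of the oriented Grassmannian -/

section Grassmannian

variable {n d : ℕ}

lemma norm_ιMulti_of_orthonormal {e : Fin d → Eucl n} (he : Orthonormal ℝ e) :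
    ‖exteriorPower.ιMulti ℝ d e‖ = 1 := by
  rw [norm_eq_sqrt_real_inner, exteriorPower.inner_ιMulti_self,
    Matrix.gram_eq_one_iff_orthonormal.mpr he, Matrix.det_one, Real.sqrt_one]

lemma continuous_ιMulti : Continuous fun u : Fin d → Eucl n => exteriorPower.ιMulti ℝ d u := by
  have h : ∀ ξ : ⋀[ℝ]^d (Eucl n),
      Continuous fun u : Fin d → Eucl n => inner ℝ (exteriorPower.ιMulti ℝ d u) ξ := by
    intro ξ
    have hξ : ξ ∈ Submodule.span ℝ (range (exteriorPower.ιMulti ℝ d (M := Eucl n))) := by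
      rw [exteriorPower.ιMulti_span]; trivial
    induction hξ using Submodule.span_induction with
    | mem ξ h =>
      obtain ⟨w, rfl⟩ := h
      simp_rw [exteriorPower.inner_ιMulti_ιMulti]
      refine Continuous.matrix_det (continuous_matrix fun i j => ?_)
      have hj : Continuous fun u : Fin d → Eucl n => u j := continuous_apply j
      exact hj.inner continuous_const
    | zero => simpa using continuous_const
    | add ξ ζ _ _ h1 h2 =>
      simp_rw [inner_add_right]
      exact h1.add h2
    | smul c ξ _ h1 =>
      simp_rw [real_inner_smul_right]
      exact continuous_const.mul h1
  exact continuous_iff_continuousAt.2 fun u =>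
    tendsto_of_tendsto_inner fun ξ => (h ξ).continuousAt

lemma continuous_exteriorPower_map {X : Type*} [TopologicalSpace X]
    {f : X → Eucl n →L[ℝ] Eucl n} {g : X → ⋀[ℝ]^d (Eucl n)} (hf : Continuous f)
    (hg : Continuous g) :
    Continuous fun p => exteriorPower.map d (f p : Eucl n →ₗ[ℝ] Eucl n) (g p) := by
  set b := (EuclideanSpace.basisFun (Fin n) ℝ).toBasis.exteriorPower d with hb
  have h : ∀ p, exteriorPower.map d (f p : Eucl n →ₗ[ℝ] Eucl n) (g p) =
        ∑ s, b.equivFun (g p) s • exteriorPower.map d (f p : Eucl n →ₗ[ℝ] Eucl n) (b s) :=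
    fun p => by
      conv_lhs => rw [← b.sum_equivFun (g p)]
      simp only [map_sum, map_smul]
  simp_rw [h]
  refine continuous_finsetSum _ fun s _ => Continuous.fun_smul ?_ ?_
  · exact (continuous_apply s).comp
      ((LinearMap.continuous_of_finiteDimensional b.equivFun.toLinearMap).comp hg)
  · have h2 : ∀ p, exteriorPower.map d (f p : Eucl n →ₗ[ℝ] Eucl n) (b s) =
        exteriorPower.ιMulti ℝ d
          (fun i => f p ((EuclideanSpace.basisFun (Fin n) ℝ).toBasis
            (Set.powersetCard.ofFinEmbEquiv.symm s i))) := fun p => by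
      rw [hb, exteriorPower.basis_apply, exteriorPower.ιMulti_family,
        exteriorPower.map_apply_ιMulti]
      rfl
    simp_rw [h2]
    refine continuous_ιMulti.comp (continuous_pi fun i => ?_)
    fun_prop

lemma ιMulti_eq_smul_of_orthonormalBasis {S : Submodule ℝ (Eucl n)}
    (b : OrthonormalBasis (Fin d) ℝ S) (u : Fin d → S) :
    exteriorPower.ιMulti ℝ d (fun i => (u i : Eucl n)) =
      b.toBasis.det u • exteriorPower.ιMulti ℝ d (fun i => (b i : Eucl n)) := by
  refine ext_inner_left ℝ fun ξ => ?_
  have h := ((innerₗ _ ξ).compAlternatingMap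
    ((exteriorPower.ιMulti ℝ d).compLinearMap S.subtype)).eq_smul_basis_det b.toBasis
  have h' := congrArg (fun f => f u) h
  refine Eq.trans ?_ (real_inner_smul_right ξ _ (b.toBasis.det u)).symm
  rw [mul_comm]
  simpa [Function.comp_def] using h'

lemma exists_orthonormal_ιMulti_eq {u : Fin d → Eucl n} (hu : LinearIndependent ℝ u) :
    ∃ e : Fin d → Eucl n, Orthonormal ℝ e ∧
      ‖exteriorPower.ιMulti ℝ d u‖⁻¹ • exteriorPower.ιMulti ℝ d u =
        exteriorPower.ιMulti ℝ d e := by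
  obtain rfl | hd := Nat.eq_zero_or_pos d
  · have he : Orthonormal ℝ u := ⟨fun i => i.elim0, fun i => i.elim0⟩
    exact ⟨u, he, by rw [norm_ιMulti_of_orthonormal he]; simp⟩
  · have : Nonempty (Fin d) := ⟨⟨0, hd⟩⟩
    set S := Submodule.span ℝ (range u)
    set β : Module.Basis (Fin d) ℝ S := Module.Basis.span hu with hβ
    have hfr : Module.finrank ℝ S = d := by
      rw [Module.finrank_eq_card_basis β, Fintype.card_fin]
    set b := ((stdOrthonormalBasis ℝ S).reindex (finCongr hfr)).adjustToOrientation β.orientation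
    have hpos : 0 < b.toBasis.det β := by
      rw [← Module.Basis.orientation_eq_iff_det_pos]
      exact OrthonormalBasis.orientation_adjustToOrientation _ _
    have he : Orthonormal ℝ (fun i => (b i : Eucl n)) :=
      b.orthonormal.comp_linearIsometry S.subtypeₗᵢ
    refine ⟨_, he, ?_⟩
    have h := ιMulti_eq_smul_of_orthonormalBasis b β
    have hu' : (fun i => (β i : Eucl n)) = u :=
      funext fun i => congrArg Subtype.val (Module.Basis.span_apply hu i)
    rw [hu'] at h
    rw [h, norm_smul, norm_ιMulti_of_orthonormal he, mul_one, Real.norm_of_nonneg hpos.le,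
      smul_smul, inv_mul_cancel₀ hpos.ne', one_smul]

lemma isCompact_setOf_orthonormal : IsCompact {e : Fin d → Eucl n | Orthonormal ℝ e} := by
  refine (isCompact_closedBall (0 : Fin d → Eucl n) 1).of_isClosed_subset ?_ ?_
  · simp_rw [orthonormal_iff_ite, ofPred_forall]
    refine isClosed_iInter fun i => isClosed_iInter fun j => isClosed_eq ?_ continuous_const
    fun_prop
  · intro e he
    rw [mem_closedBall_zero_iff, pi_norm_le_iff_of_nonneg zero_le_one]
    exact fun i => (he.1 i).le

instance OrientedGrassmannian.instCompactSpace : CompactSpace (OrientedGrassmannian n d) := by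
  have h : {ξ : ⋀[ℝ]^d (Eucl n) | ∃ u : Fin d → Eucl n, LinearIndependent ℝ u ∧
      ξ = ‖exteriorPower.ιMulti ℝ d u‖⁻¹ • exteriorPower.ιMulti ℝ d u} =
      (fun u => exteriorPower.ιMulti ℝ d u) '' {e : Fin d → Eucl n | Orthonormal ℝ e} := by
    ext ξ
    constructor
    · rintro ⟨u, hu, rfl⟩
      obtain ⟨e, he, h⟩ := exists_orthonormal_ιMulti_eq hu
      exact ⟨e, he, h.symm⟩
    · rintro ⟨e, he, rfl⟩
      exact ⟨e, he.linearIndependent, by rw [norm_ιMulti_of_orthonormal he]; simp⟩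
  have hc := isCompact_setOf_orthonormal.image (continuous_ιMulti (n := n) (d := d))
  rw [← h] at hc
  exact isCompact_iff_compactSpace.1 hc

namespace OrientedGrassmannian

lemma norm_coe (T : OrientedGrassmannian n d) : ‖T.1‖ = 1 := by
  obtain ⟨ξ, u, hu, rfl⟩ := T
  obtain ⟨e, he, h⟩ := exists_orthonormal_ιMulti_eq hu
  exact (congrArg norm h).trans (norm_ιMulti_of_orthonormal he)

lemma isInducing_coe :
    IsInducing (Subtype.val : OrientedGrassmannian n d → ⋀[ℝ]^d (Eucl n)) := ⟨rfl⟩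

lemma nonempty (hd : d ≤ n) : Nonempty (OrientedGrassmannian n d) := by
  have h : Orthonormal ℝ fun i : Fin d => EuclideanSpace.basisFun (Fin n) ℝ (Fin.castLE hd i) :=
    (EuclideanSpace.basisFun (Fin n) ℝ).orthonormal.comp _ (Fin.castLE_injective hd)
  exact ⟨⟨_, _, h.linearIndependent, rfl⟩⟩

lemma jac_nonneg (A : Eucl n →L[ℝ] Eucl n) (T : OrientedGrassmannian n d) : 0 ≤ T.jac A :=
  norm_nonneg _

lemma _root_.Continuous.jac {X : Type*} [TopologicalSpace X] {f : X → Eucl n →L[ℝ] Eucl n}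
    {g : X → OrientedGrassmannian n d} (hf : Continuous f) (hg : Continuous g) :
    Continuous fun x => (g x).jac (f x) :=
  (continuous_exteriorPower_map hf (isInducing_coe.continuous.comp hg)).norm

lemma continuous_jac :
    Continuous fun p : (Eucl n →L[ℝ] Eucl n) × OrientedGrassmannian n d => p.2.jac p.1 :=
  continuous_fst.jac continuous_snd

lemma continuousOn_act :
    ContinuousOn (fun p : (Eucl n →L[ℝ] Eucl n) × OrientedGrassmannian n d => p.2.act p.1)
      {p | p.2.jac p.1 ≠ 0} := by
  rw [isInducing_coe.continuousOn_iff]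
  have h : ContinuousOn (fun p : (Eucl n →L[ℝ] Eucl n) × OrientedGrassmannian n d =>
      (p.2.jac p.1)⁻¹ • exteriorPower.map d (p.1 : Eucl n →ₗ[ℝ] Eucl n) p.2.1)
      {p | p.2.jac p.1 ≠ 0} :=
    (continuous_jac.continuousOn.inv₀ fun p hp => hp).smul
      (continuous_exteriorPower_map continuous_fst
        (isInducing_coe.continuous.comp continuous_snd)).continuousOn
  refine h.congr fun p hp => ?_
  have hp' : exteriorPower.map d (p.1 : Eucl n →ₗ[ℝ] Eucl n) p.2.1 ≠ 0 := norm_ne_zero_iff.1 hp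
  simp only [Function.comp_apply, act, dif_neg hp', jac]

lemma act_of_jac_eq_zero {A : Eucl n →L[ℝ] Eucl n} {T : OrientedGrassmannian n d}
    (h : T.jac A = 0) : T.act A = T := dif_pos (norm_eq_zero.1 h)

lemma measurable_act :
    Measurable fun p : (Eucl n →L[ℝ] Eucl n) × OrientedGrassmannian n d => p.2.act p.1 := by
  classical
  have hopen : IsOpen {p : (Eucl n →L[ℝ] Eucl n) × OrientedGrassmannian n d | p.2.jac p.1 ≠ 0} :=
    isOpen_ne_fun continuous_jac continuous_const
  refine measurable_of_isOpen fun U hU => ?_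
  have h : (fun p : (Eucl n →L[ℝ] Eucl n) × OrientedGrassmannian n d => p.2.act p.1) ⁻¹' U =
      ({p | p.2.jac p.1 ≠ 0} ∩ (fun p : (Eucl n →L[ℝ] Eucl n) × OrientedGrassmannian n d =>
        p.2.act p.1) ⁻¹' U) ∪ ({p | p.2.jac p.1 ≠ 0}ᶜ ∩ Prod.snd ⁻¹' U) := by
    ext p
    by_cases hp : p.2.jac p.1 = 0
    · simp [hp, act_of_jac_eq_zero hp]
    · simp [hp]
  rw [h]
  exact (continuousOn_act.isOpen_inter_preimage hopen hU).measurableSet.union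
    (hopen.measurableSet.compl.inter (hU.preimage continuous_snd).measurableSet)

lemma _root_.Measurable.act {X : Type*} [MeasurableSpace X] {f : X → Eucl n →L[ℝ] Eucl n}
    {g : X → OrientedGrassmannian n d} (hf : Measurable f) (hg : Measurable g) :
    Measurable fun x => (g x).act (f x) := by
  have h := hf.prodMk hg
  have h' := Measurable.comp measurable_act h
  exact h'

end OrientedGrassmannian

end Grassmannian

/-! ### Mean embeddings of measures into a reproducing kernel Hilbert space -/

section MeanEmbedding

variable {X : Type*} {W : Type*} [NormedAddCommGroup W] [InnerProductSpace ℝ W] [CompleteSpace W]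
  [RKHS ℝ W X ℝ]

lemma RKHS.inner_kerFun_one (ω : W) (p : X) : inner ℝ ω (RKHS.kerFun W p 1) = ω p := by
  rw [RKHS.inner_kerFun]
  simp

lemma RKHS.inner_kerFun_one_kerFun_one (p q : X) :
    inner ℝ (RKHS.kerFun W p (1 : ℝ)) (RKHS.kerFun W q 1) = RKHS.kernel W q p 1 := by
  rw [RKHS.inner_kerFun_one, RKHS.kerFun_apply]

variable [MeasurableSpace X]

/-- The mean embedding of a measure, which represents `ω ↦ ∫ ω dμ`. -/
noncomputable def meanEmbedding (W : Type*) [NormedAddCommGroup W] [InnerProductSpace ℝ W]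
    [CompleteSpace W] [RKHS ℝ W X ℝ] (μ : Measure X) : W :=
  ∫ p, RKHS.kerFun W p (1 : ℝ) ∂μ

lemma inner_meanEmbedding {μ : Measure X} (hμ : Integrable (fun p => RKHS.kerFun W p (1 : ℝ)) μ)
    (ω : W) : inner ℝ ω (meanEmbedding W μ) = ∫ p, ω p ∂μ := by
  rw [meanEmbedding, ← integral_inner hμ]
  simp_rw [RKHS.inner_kerFun_one]

lemma dualDist_eq_norm_sub {μ ν : Measure X}
    (hμ : Integrable (fun p => RKHS.kerFun W p (1 : ℝ)) μ)
    (hν : Integrable (fun p => RKHS.kerFun W p (1 : ℝ)) ν) :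
    dualDist W μ ν = ‖meanEmbedding W μ - meanEmbedding W ν‖ := by
  set m := meanEmbedding W μ - meanEmbedding W ν with hm
  have h : ∀ ω : W, (∫ p, ω p ∂μ) - ∫ p, ω p ∂ν = inner ℝ ω m := fun ω => by
    rw [hm, inner_sub_right, inner_meanEmbedding hμ, inner_meanEmbedding hν]
  rw [dualDist]
  simp_rw [h]
  refine IsLUB.csSup_eq ⟨?_, fun b hb => ?_⟩ ((Metric.nonempty_closedBall.2 zero_le_one).image _)
  · rintro _ ⟨ω, hω, rfl⟩
    have hω' : ‖ω‖ ≤ 1 := by simpa using hω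
    exact (real_inner_le_norm ω m).trans (mul_le_of_le_one_left (norm_nonneg m) hω')
  · rcases eq_or_ne m 0 with h0 | h0
    · rw [h0, norm_zero]
      exact hb ⟨0, by simp, by simp⟩
    · refine hb ⟨‖m‖⁻¹ • m, ?_, ?_⟩
      · rw [mem_closedBall_zero_iff, norm_smul, norm_inv, norm_norm,
          inv_mul_cancel₀ (norm_ne_zero_iff.2 h0)]
      · simp only
        rw [real_inner_smul_left, real_inner_self_eq_norm_mul_norm, ← mul_assoc,
          inv_mul_cancel₀ (norm_ne_zero_iff.2 h0), one_mul]

end MeanEmbedding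

lemma continuous_of_continuous_inner {X E : Type*} [TopologicalSpace X] [NormedAddCommGroup E]
    [InnerProductSpace ℝ E] {f : X → E}
    (h : Continuous fun p : X × X => inner ℝ (f p.1) (f p.2)) : Continuous f := by
  refine continuous_iff_continuousAt.2 fun p => ?_
  rw [ContinuousAt, tendsto_iff_norm_sub_tendsto_zero]
  have h1 : Continuous fun q => inner ℝ (f q) (f q) := h.comp (continuous_id.prodMk continuous_id)
  have h2 : Continuous fun q => inner ℝ (f q) (f p) :=
    h.comp (continuous_id.prodMk continuous_const)
  have h3 : Continuous fun q => √(inner ℝ (f q) (f q) - 2 * inner ℝ (f q) (f p) +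
      inner ℝ (f p) (f p)) := by fun_prop
  have h4 : ∀ q, ‖f q - f p‖ = √(inner ℝ (f q) (f q) - 2 * inner ℝ (f q) (f p) +
      inner ℝ (f p) (f p)) := fun q => by
    rw [← real_inner_sub_sub_self, ← norm_eq_sqrt_real_inner]
  simp_rw [h4]
  have h5 := h3.tendsto p
  rwa [← h4 p, sub_self, norm_zero] at h5

section VarifoldKernel

variable {n d : ℕ} {W : Type*} [NormedAddCommGroup W] [InnerProductSpace ℝ W] [CompleteSpace W]
  [RKHS ℝ W (VarifoldSpace n d) ℝ] {ρ γ : ℝ → ℝ}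

lemma continuous_kerFun_one (hργ : KernelConditions n d ρ γ)
    (hW : ∀ p q : VarifoldSpace n d, RKHS.kernel W p q 1 = varifoldKernel ρ γ p q) :
    Continuous fun p : VarifoldSpace n d => RKHS.kerFun W p (1 : ℝ) := by
  refine continuous_of_continuous_inner ?_
  simp_rw [RKHS.inner_kerFun_one_kerFun_one, hW, varifoldKernel]
  have h1 : Continuous fun p : VarifoldSpace n d × VarifoldSpace n d =>
      ρ (‖p.2.1 - p.1.1‖ ^ 2) := hργ.pos_continuous.comp (f := fun p :
        VarifoldSpace n d × VarifoldSpace n d => (p.2.1, p.1.1)) (by fun_prop)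
  have h2 : Continuous fun p : VarifoldSpace n d × VarifoldSpace n d =>
      γ (inner ℝ p.2.2.1 p.1.2.1) := hργ.grass_continuous.comp (f := fun p :
        VarifoldSpace n d × VarifoldSpace n d => (p.2.2, p.1.2)) (by fun_prop)
  exact h1.mul h2

lemma norm_kerFun_one
    (hW : ∀ p q : VarifoldSpace n d, RKHS.kernel W p q 1 = varifoldKernel ρ γ p q)
    (p : VarifoldSpace n d) : ‖RKHS.kerFun W p (1 : ℝ)‖ = √(ρ 0 * γ 1) := by
  rw [norm_eq_sqrt_real_inner, RKHS.inner_kerFun_one_kerFun_one, hW, varifoldKernel,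
    real_inner_self_eq_norm_sq, p.2.norm_coe]
  simp

/-- The contribution `J_T(A) k_{(y, A · T)}` of a point to the mean embedding of a pushforward. -/
noncomputable def pushFeature (W : Type*) [NormedAddCommGroup W] [InnerProductSpace ℝ W]
    [CompleteSpace W] [RKHS ℝ W (VarifoldSpace n d) ℝ]
    (q : Eucl n × (Eucl n →L[ℝ] Eucl n) × OrientedGrassmannian n d) : W :=
  q.2.2.jac q.2.1 • RKHS.kerFun W (q.1, q.2.2.act q.2.1) (1 : ℝ)

lemma continuous_pushFeature (hργ : KernelConditions n d ρ γ)
    (hW : ∀ p q : VarifoldSpace n d, RKHS.kernel W p q 1 = varifoldKernel ρ γ p q) :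
    Continuous (pushFeature (n := n) (d := d) W) := by
  have hjac : Continuous fun q : Eucl n × (Eucl n →L[ℝ] Eucl n) × OrientedGrassmannian n d =>
      q.2.2.jac q.2.1 := OrientedGrassmannian.continuous_jac.comp continuous_snd
  refine continuous_iff_continuousAt.2 fun q => ?_
  by_cases hq : q.2.2.jac q.2.1 = 0
  · have h0 : pushFeature W q = 0 := by rw [pushFeature, hq, zero_smul]
    rw [ContinuousAt, h0, tendsto_zero_iff_norm_tendsto_zero]
    have h1 : Tendsto (fun q : Eucl n × (Eucl n →L[ℝ] Eucl n) × OrientedGrassmannian n d =>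
        q.2.2.jac q.2.1 * √(ρ 0 * γ 1)) (𝓝 q) (𝓝 0) := by
      have := (hjac.tendsto q).mul_const (√(ρ 0 * γ 1))
      rwa [hq, zero_mul] at this
    refine h1.congr fun q => ?_
    rw [pushFeature, norm_smul, norm_kerFun_one hW,
      Real.norm_of_nonneg (OrientedGrassmannian.jac_nonneg _ _)]
  · have hact : ContinuousAt (fun q : Eucl n × (Eucl n →L[ℝ] Eucl n) × OrientedGrassmannian n d =>
        q.2.2.act q.2.1) q := by
      have h1 := OrientedGrassmannian.continuousOn_act.continuousAt
        ((isOpen_ne_fun OrientedGrassmannian.continuous_jac continuous_const).mem_nhds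
          (x := q.2) hq)
      exact ContinuousAt.comp (f := Prod.snd) (x := q) h1 continuousAt_snd
    exact hjac.continuousAt.smul (ContinuousAt.comp
      (f := fun q : Eucl n × (Eucl n →L[ℝ] Eucl n) × OrientedGrassmannian n d =>
        (q.1, q.2.2.act q.2.1)) (x := q)
      (continuous_kerFun_one hργ hW).continuousAt (continuousAt_fst.prodMk hact))

variable {φ : Eucl n → Eucl n} {μ : Measure (VarifoldSpace n d)}

lemma measurable_pushforward_map (hφ : Continuous φ) (hφ' : Continuous (fderiv ℝ φ)) :
    Measurable fun p : VarifoldSpace n d => (φ p.1, p.2.act (fderiv ℝ φ p.1)) := by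
  exact (hφ.comp continuous_fst).measurable.prodMk
    ((hφ'.comp continuous_fst).measurable.act measurable_snd)

lemma measurable_jac_fderiv (hφ' : Continuous (fderiv ℝ φ)) :
    Measurable fun p : VarifoldSpace n d => ENNReal.ofReal (p.2.jac (fderiv ℝ φ p.1)) := by
  exact ((hφ'.comp continuous_fst).jac continuous_snd).measurable.ennreal_ofReal

lemma integrable_kerFun_varifoldPushforward (hργ : KernelConditions n d ρ γ)
    (hW : ∀ p q : VarifoldSpace n d, RKHS.kernel W p q 1 = varifoldKernel ρ γ p q)
    (hφ : Continuous φ) (hφ' : Continuous (fderiv ℝ φ))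
    (h : Integrable (fun p => pushFeature W (φ p.1, fderiv ℝ φ p.1, p.2)) μ) :
    Integrable (fun p => RKHS.kerFun W p (1 : ℝ)) (varifoldPushforward φ μ) := by
  rw [varifoldPushforward, integrable_map_measure
    (continuous_kerFun_one hργ hW).aestronglyMeasurable
    (measurable_pushforward_map hφ hφ').aemeasurable,
    integrable_withDensity_iff_integrable_smul' (measurable_jac_fderiv hφ')
      (Eventually.of_forall fun _ => ENNReal.ofReal_lt_top)]
  refine h.congr (Eventually.of_forall fun p => ?_)
  simp only [pushFeature, Function.comp_apply]
  rw [ENNReal.toReal_ofReal (OrientedGrassmannian.jac_nonneg _ _)]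

lemma meanEmbedding_varifoldPushforward (hργ : KernelConditions n d ρ γ)
    (hW : ∀ p q : VarifoldSpace n d, RKHS.kernel W p q 1 = varifoldKernel ρ γ p q)
    (hφ : Continuous φ) (hφ' : Continuous (fderiv ℝ φ)) :
    meanEmbedding W (varifoldPushforward φ μ) =
      ∫ p, pushFeature W (φ p.1, fderiv ℝ φ p.1, p.2) ∂μ := by
  rw [meanEmbedding, varifoldPushforward, integral_map
    (measurable_pushforward_map hφ hφ').aemeasurable
    (continuous_kerFun_one hργ hW).aestronglyMeasurable,
    integral_withDensity_eq_integral_toReal_smul (measurable_jac_fderiv hφ')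
      (Eventually.of_forall fun _ => ENNReal.ofReal_lt_top)]
  refine integral_congr_ae (Eventually.of_forall fun p => ?_)
  simp only [pushFeature]
  rw [ENNReal.toReal_ofReal (OrientedGrassmannian.jac_nonneg _ _)]

end VarifoldKernel

/-! ### Measures that are concentrated over a compact set -/

section Concentrated

variable {n d : ℕ}

lemma ae_mem_of_support_weightMeasure_subset {μ : Measure (VarifoldSpace n d)} {K : Set (Eucl n)}
    (h : (weightMeasure μ).support ⊆ K) : ∀ᵐ p ∂μ, p.1 ∈ K := by
  have h1 : ∀ᵐ x ∂(weightMeasure μ), x ∈ (weightMeasure μ).support := Measure.support_mem_ae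
  filter_upwards [ae_of_ae_map measurable_fst.aemeasurable h1] with p hp using h hp

lemma support_weightMeasure_subset_of_ae_mem {μ : Measure (VarifoldSpace n d)} {K : Set (Eucl n)}
    (hK : IsClosed K) (h : ∀ᵐ p ∂μ, p.1 ∈ K) : (weightMeasure μ).support ⊆ K := by
  refine Measure.support_subset_of_isClosed hK ?_
  exact (ae_map_iff measurable_fst.aemeasurable hK.measurableSet).2 h

lemma exists_bound_of_continuous {K : Set (Eucl n)} (hK : IsCompact K) {F : Type*}
    [NormedAddCommGroup F] {Φ : VarifoldSpace n d → F} (hΦ : Continuous Φ) :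
    ∃ M, ∀ p : VarifoldSpace n d, p.1 ∈ K → ‖Φ p‖ ≤ M := by
  obtain ⟨M, hM⟩ := (hK.prod isCompact_univ).exists_bound_of_continuousOn
    (f := Φ) hΦ.continuousOn
  exact ⟨M, fun p hp => hM p ⟨hp, mem_univ _⟩⟩

lemma integrable_of_continuous_of_ae_mem {K : Set (Eucl n)} (hK : IsCompact K) {F : Type*}
    [NormedAddCommGroup F] {Φ : VarifoldSpace n d → F} (hΦ : Continuous Φ)
    {μ : Measure (VarifoldSpace n d)} [IsFiniteMeasure μ] (h : ∀ᵐ p ∂μ, p.1 ∈ K) :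
    Integrable Φ μ := by
  obtain ⟨M, hM⟩ := exists_bound_of_continuous hK hΦ
  exact Integrable.of_bound hΦ.aestronglyMeasurable M (h.mono hM)

end Concentrated

/-! ### Discrete approximation -/

section Discrete

variable {n d : ℕ}

lemma discreteVarifolds_mono (hd : d ≤ n) : Monotone (discreteVarifolds n d) := by
  refine monotone_nat_of_le_succ fun N => ?_
  rintro _ ⟨r, x, T, rfl⟩
  obtain ⟨T₀⟩ := OrientedGrassmannian.nonempty hd
  exact ⟨Fin.cons 0 r, Fin.cons 0 x, Fin.cons T₀ T, by simp [Fin.sum_univ_succ]⟩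

lemma isFiniteMeasure_of_mem_discreteVarifolds {N : ℕ} {ν : Measure (VarifoldSpace n d)}
    (h : ν ∈ discreteVarifolds n d N) : IsFiniteMeasure ν := by
  obtain ⟨r, x, T, rfl⟩ := h
  infer_instance

variable {W : Type*} [NormedAddCommGroup W] [InnerProductSpace ℝ W] [CompleteSpace W]
  [RKHS ℝ W (VarifoldSpace n d) ℝ]

lemma exists_mem_discreteVarifolds_meanEmbedding_close
    (hk : Continuous fun p : VarifoldSpace n d => RKHS.kerFun W p (1 : ℝ))
    {K : Set (Eucl n)} (hK : IsCompact K) {μ : Measure (VarifoldSpace n d)} [IsFiniteMeasure μ]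
    (hμ : ∀ᵐ p ∂μ, p.1 ∈ K) {ε : ℝ} (hε : 0 < ε) :
    ∃ M, ∃ ν ∈ discreteVarifolds n d M, (weightMeasure ν).support ⊆ K ∧
      ‖meanEmbedding W ν - meanEmbedding W μ‖ < ε := by
  rcases eq_or_ne μ 0 with rfl | hμ0
  · exact ⟨0, 0, ⟨fun i => i.elim0, fun i => i.elim0, fun i => i.elim0, by simp⟩,
      support_weightMeasure_subset_of_ae_mem hK.isClosed (by simp), by simpa using hε⟩
  have : NeZero μ := ⟨hμ0⟩
  set k : VarifoldSpace n d → W := fun p => RKHS.kerFun W p (1 : ℝ) with hkdef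
  set S := k '' {p | p.1 ∈ K}
  set c := μ.real univ
  have hc : 0 < c := measureReal_univ_pos
  have havg : (⨍ p, k p ∂μ) ∈ closure (convexHull ℝ S) :=
    (convex_convexHull ℝ S).closure.average_mem isClosed_closure
      (hμ.mono fun p hp => subset_closure (subset_convexHull ℝ S ⟨p, hp, rfl⟩))
      (integrable_of_continuous_of_ae_mem hK hk hμ)
  obtain ⟨w, hw, hdist⟩ := Metric.mem_closure_iff.1 havg (ε / c) (div_pos hε hc)
  obtain ⟨ι, _, a, z, ha, -, hz, rfl⟩ := mem_convexHull_iff_exists_fintype.1 hw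
  choose p hpK hp using hz
  set e := (Fintype.equivFin ι).symm
  refine ⟨Fintype.card ι, ∑ i, (c * a (e i)).toNNReal • Measure.dirac (p (e i)),
    ⟨fun i => (c * a (e i)).toNNReal, fun i => (p (e i)).1, fun i => (p (e i)).2, rfl⟩, ?_, ?_⟩
  · refine support_weightMeasure_subset_of_ae_mem hK.isClosed ?_
    have hmeas : MeasurableSet {q : VarifoldSpace n d | q.1 ∉ K} :=
      (hK.isClosed.measurableSet.preimage measurable_fst).compl
    rw [ae_iff, Measure.finsetSum_apply]
    refine Finset.sum_eq_zero fun i _ => ?_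
    have hi : (p (e i)).1 ∈ K := hpK _
    simp [Measure.dirac_apply' _ hmeas, hi]
  · have h1 : meanEmbedding W (∑ i, (c * a (e i)).toNNReal • Measure.dirac (p (e i))) =
        c • ∑ i, a i • z i := by
      rw [meanEmbedding, integral_finsetSum_measure, ← e.sum_comp, Finset.smul_sum]
      · refine Finset.sum_congr rfl fun i _ => ?_
        rw [integral_smul_nnreal_measure, integral_dirac, ← hp (e i), NNReal.smul_def,
          Real.coe_toNNReal _ (mul_nonneg hc.le (ha _)), mul_smul]
      · intro i _
        refine Integrable.smul_measure_nnreal ?_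
        exact integrable_dirac (by finiteness)
    have h2 : meanEmbedding W μ = c • ⨍ p, k p ∂μ := (measure_smul_average μ k).symm
    rw [h1, h2, ← smul_sub, norm_smul, Real.norm_of_nonneg hc.le, ← dist_eq_norm, dist_comm]
    calc c * dist (⨍ p, k p ∂μ) (∑ i, a i • z i) < c * (ε / c) := by gcongr
      _ = ε := by field_simp

lemma tendsto_meanEmbedding_constrainedProjection (hd : d ≤ n)
    (hk : Continuous fun p : VarifoldSpace n d => RKHS.kerFun W p (1 : ℝ))
    {K : Set (Eucl n)} (hK : IsCompact K) {μ₀ : Measure (VarifoldSpace n d)} [IsFiniteMeasure μ₀]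
    (hμ₀ : ∀ᵐ p ∂μ₀, p.1 ∈ K) {μK : ℕ → Measure (VarifoldSpace n d)}
    (hμK : ∀ N, 1 ≤ N → IsConstrainedProjection W μ₀ K N (μK N)) :
    Tendsto (fun N => meanEmbedding W (μK N)) atTop (𝓝 (meanEmbedding W μ₀)) := by
  rw [Metric.tendsto_atTop]
  intro ε hε
  obtain ⟨M, ν, hν, hνK, hlt⟩ := exists_mem_discreteVarifolds_meanEmbedding_close hk hK hμ₀ hε
  refine ⟨M + 1, fun N hN => ?_⟩
  obtain ⟨h1, h2, h3⟩ := hμK N (by omega)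
  have h4 := h3 ν (discreteVarifolds_mono hd (by omega : M ≤ N) hν) hνK
  have := isFiniteMeasure_of_mem_discreteVarifolds h1
  have := isFiniteMeasure_of_mem_discreteVarifolds hν
  have hint := integrable_of_continuous_of_ae_mem hK hk hμ₀
  rw [dualDist_eq_norm_sub (integrable_of_continuous_of_ae_mem hK hk
      (ae_mem_of_support_weightMeasure_subset h2)) hint,
    dualDist_eq_norm_sub (integrable_of_continuous_of_ae_mem hK hk
      (ae_mem_of_support_weightMeasure_subset hνK)) hint] at h4
  rw [dist_eq_norm]
  exact h4.trans_lt hlt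

end Discrete

/-! ### Convergence of integrals -/

section WeakConvergence

variable {n d : ℕ} {W : Type*} [NormedAddCommGroup W] [InnerProductSpace ℝ W] [CompleteSpace W]
  [RKHS ℝ W (VarifoldSpace n d) ℝ] {K : Set (Eucl n)}

omit [CompleteSpace W] in
lemma IsC0Universal.exists_approx (huniv : IsC0Universal W) (hK : IsCompact K)
    {g : VarifoldSpace n d → ℝ} (hg : Continuous g) {ε : ℝ} (hε : 0 < ε) :
    ∃ ω : W, ∀ p : VarifoldSpace n d, p.1 ∈ K → ‖g p - ω p‖ ≤ ε := by
  obtain ⟨χ, h1, -, hχ, -⟩ := exists_continuous_one_zero_of_isCompact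
    (hK.prod (isCompact_univ (X := OrientedGrassmannian n d))) isClosed_empty (disjoint_empty _)
  let f : C₀(VarifoldSpace n d, ℝ) :=
    ⟨⟨fun p => χ p * g p, χ.continuous.mul hg⟩,
      (HasCompactSupport.mul_right (f' := g) hχ).is_zero_at_infty⟩
  obtain ⟨f', hf', ω, hω⟩ := Metric.dense_iff.1 huniv f ε hε
  refine ⟨ω, fun p hp => ?_⟩
  have h2 : χ p = 1 := h1 ⟨hp, mem_univ _⟩
  have h3 : f p = g p := by
    change χ p * g p = g p
    rw [h2, one_mul]
  rw [hω, ← h3, ← dist_eq_norm]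
  refine le_trans ?_ (Metric.mem_ball'.1 hf').le
  rw [← ZeroAtInftyContinuousMap.dist_toBCF_eq_dist]
  exact BoundedContinuousFunction.dist_coe_le_dist (f := f.toBCF) (g := f'.toBCF) p

/-- Finite measures `μ i` over `K` whose mean embeddings converge to that of the finite measure `μ₀`
over `K`. -/
structure MeanConverges (W : Type*) [NormedAddCommGroup W] [InnerProductSpace ℝ W]
    [CompleteSpace W] [RKHS ℝ W (VarifoldSpace n d) ℝ] (K : Set (Eucl n)) {ι : Type*}
    (l : Filter ι) (μ : ι → Measure (VarifoldSpace n d)) (μ₀ : Measure (VarifoldSpace n d)) :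
    Prop where
  eventually_finite : ∀ᶠ i in l, IsFiniteMeasure (μ i)
  finite : IsFiniteMeasure μ₀
  eventually_ae_mem : ∀ᶠ i in l, ∀ᵐ p ∂(μ i), p.1 ∈ K
  ae_mem : ∀ᵐ p ∂μ₀, p.1 ∈ K
  tendsto : Tendsto (fun i => meanEmbedding W (μ i)) l (𝓝 (meanEmbedding W μ₀))

variable {ι : Type*} {l : Filter ι} {μ : ι → Measure (VarifoldSpace n d)}
  {μ₀ : Measure (VarifoldSpace n d)}

lemma norm_integral_sub_le_of_ae_mem (hK : IsCompact K) {F : Type*} [NormedAddCommGroup F]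
    [NormedSpace ℝ F] {Φ Ψ : VarifoldSpace n d → F} (hΦ : Continuous Φ) (hΨ : Continuous Ψ)
    {ν : Measure (VarifoldSpace n d)} [IsFiniteMeasure ν] (hν : ∀ᵐ p ∂ν, p.1 ∈ K) {ε : ℝ}
    (h : ∀ p, p.1 ∈ K → ‖Φ p - Ψ p‖ ≤ ε) :
    ‖(∫ p, Φ p ∂ν) - ∫ p, Ψ p ∂ν‖ ≤ ε * ν.real univ := by
  rw [← integral_sub (integrable_of_continuous_of_ae_mem hK hΦ hν)
    (integrable_of_continuous_of_ae_mem hK hΨ hν)]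
  exact norm_integral_le_of_norm_le_const (hν.mono h)

namespace MeanConverges

variable (hμ : MeanConverges W K l μ μ₀)

include hμ

lemma mono {l' : Filter ι} (h : l' ≤ l) : MeanConverges W K l' μ μ₀ :=
  ⟨h hμ.eventually_finite, hμ.finite, h hμ.eventually_ae_mem, hμ.ae_mem, hμ.tendsto.mono_left h⟩

lemma eventually_measureReal_le (huniv : IsC0Universal W) (hK : IsCompact K)
    (hk : Continuous fun p : VarifoldSpace n d => RKHS.kerFun W p (1 : ℝ)) :
    ∃ M, 0 < M ∧ μ₀.real univ ≤ M ∧ ∀ᶠ i in l, (μ i).real univ ≤ M := by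
  obtain ⟨ω, hω⟩ := huniv.exists_approx hK (g := fun _ => 2) continuous_const one_pos
  have hω1 : ∀ p : VarifoldSpace n d, p.1 ∈ K → 1 ≤ ω p := fun p hp => by
    have := (abs_le.1 (hω p hp)).2
    linarith
  have key : ∀ ν : Measure (VarifoldSpace n d), IsFiniteMeasure ν → (∀ᵐ p ∂ν, p.1 ∈ K) →
      ν.real univ ≤ ‖ω‖ * ‖meanEmbedding W ν‖ := fun ν _ hν => by
    have hint := integrable_of_continuous_of_ae_mem hK hk hν
    have hωi : Integrable (fun p => ω p) ν := by
      have := hint.const_inner (𝕜 := ℝ) ω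
      simpa only [RKHS.inner_kerFun_one] using this
    calc ν.real univ = ∫ _, (1 : ℝ) ∂ν := by simp
      _ ≤ ∫ p, ω p ∂ν := integral_mono_ae (integrable_const _) hωi (hν.mono hω1)
      _ = inner ℝ ω (meanEmbedding W ν) := (inner_meanEmbedding hint ω).symm
      _ ≤ _ := real_inner_le_norm _ _
  refine ⟨‖ω‖ * (‖meanEmbedding W μ₀‖ + 1) + 1, by positivity, ?_, ?_⟩
  · have := key μ₀ hμ.finite hμ.ae_mem
    nlinarith [norm_nonneg ω]
  · filter_upwards [hμ.eventually_finite, hμ.eventually_ae_mem,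
      hμ.tendsto.norm.eventually_lt_const (lt_add_one _)] with i h1 h2 h3
    have := key _ h1 h2
    nlinarith [norm_nonneg ω]

/-- Convergence of integrals is stable under uniform approximation over the compact set. -/
lemma tendsto_integral_of_approx (huniv : IsC0Universal W) (hK : IsCompact K)
    (hk : Continuous fun p : VarifoldSpace n d => RKHS.kerFun W p (1 : ℝ))
    {F : Type*} [NormedAddCommGroup F] [NormedSpace ℝ F] {Φ : VarifoldSpace n d → F}
    {Φs : ι → VarifoldSpace n d → F} (hΦ : Continuous Φ) (hΦs : ∀ i, Continuous (Φs i))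
    (h : ∀ ε > 0, ∃ Ψ : VarifoldSpace n d → F, Continuous Ψ ∧
      Tendsto (fun i => ∫ p, Ψ p ∂(μ i)) l (𝓝 (∫ p, Ψ p ∂μ₀)) ∧
      (∀ p, p.1 ∈ K → ‖Φ p - Ψ p‖ ≤ ε) ∧ ∀ᶠ i in l, ∀ p, p.1 ∈ K → ‖Φs i p - Ψ p‖ ≤ ε) :
    Tendsto (fun i => ∫ p, Φs i p ∂(μ i)) l (𝓝 (∫ p, Φ p ∂μ₀)) := by
  obtain ⟨M, hM0, hM, hMi⟩ := hμ.eventually_measureReal_le huniv hK hk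
  rw [tendsto_iff_norm_sub_tendsto_zero, Metric.tendsto_nhds]
  intro ε hε
  obtain ⟨Ψ, hΨ, hlim, hΦΨ, hΦsΨ⟩ := h (ε / (4 * M)) (by positivity)
  have := hμ.finite
  have h0 := norm_integral_sub_le_of_ae_mem hK hΦ hΨ hμ.ae_mem hΦΨ
  have hεM : ε / (4 * M) * M = ε / 4 := by field_simp
  filter_upwards [hμ.eventually_finite, hμ.eventually_ae_mem, hMi, hΦsΨ,
    (tendsto_iff_norm_sub_tendsto_zero.1 hlim).eventually_lt_const
      (by positivity : 0 < ε / 4)] with i h1 h2 h3 h4 h5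
  have h6 := norm_integral_sub_le_of_ae_mem hK (hΦs i) hΨ h2 h4
  have h7 : ε / (4 * M) * (μ i).real univ ≤ ε / 4 := by
    rw [← hεM]
    gcongr
  have h8 : ε / (4 * M) * μ₀.real univ ≤ ε / 4 := by
    rw [← hεM]
    gcongr
  rw [Real.dist_0_eq_abs, abs_norm]
  set a := ∫ p, Φs i p ∂(μ i)
  set b := ∫ p, Φ p ∂μ₀
  set a' := ∫ p, Ψ p ∂(μ i)
  set b' := ∫ p, Ψ p ∂μ₀
  rw [show a - b = (a - a') + (a' - b') - (b - b') by abel]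
  have h9 := norm_sub_le (a - a' + (a' - b')) (b - b')
  have h10 := norm_add_le (a - a') (a' - b')
  linarith

lemma tendsto_integral_real (huniv : IsC0Universal W) (hK : IsCompact K)
    (hk : Continuous fun p : VarifoldSpace n d => RKHS.kerFun W p (1 : ℝ))
    {g : VarifoldSpace n d → ℝ} (hg : Continuous g) :
    Tendsto (fun i => ∫ p, g p ∂(μ i)) l (𝓝 (∫ p, g p ∂μ₀)) := by
  refine hμ.tendsto_integral_of_approx huniv hK hk hg (fun _ => hg) fun ε hε => ?_
  obtain ⟨ω, hω⟩ := huniv.exists_approx hK hg hε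
  have := hμ.finite
  refine ⟨ω, ?_, ?_, hω, Eventually.of_forall fun _ => hω⟩
  · have : Continuous fun p => inner ℝ ω (RKHS.kerFun W p (1 : ℝ)) := continuous_const.inner hk
    simpa only [RKHS.inner_kerFun_one] using this
  · rw [← inner_meanEmbedding (integrable_of_continuous_of_ae_mem hK hk hμ.ae_mem)]
    refine (Tendsto.inner tendsto_const_nhds hμ.tendsto).congr' ?_
    filter_upwards [hμ.eventually_finite, hμ.eventually_ae_mem] with i h1 h2
    exact inner_meanEmbedding (integrable_of_continuous_of_ae_mem hK hk h2) ω

lemma tendsto_integral (huniv : IsC0Universal W) (hK : IsCompact K)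
    (hk : Continuous fun p : VarifoldSpace n d => RKHS.kerFun W p (1 : ℝ))
    {F : Type*} [NormedAddCommGroup F] [InnerProductSpace ℝ F] [CompleteSpace F]
    {Φ : VarifoldSpace n d → F} (hΦ : Continuous Φ) :
    Tendsto (fun i => ∫ p, Φ p ∂(μ i)) l (𝓝 (∫ p, Φ p ∂μ₀)) := by
  refine hμ.tendsto_integral_of_approx huniv hK hk hΦ (fun _ => hΦ) fun ε hε => ?_
  have := hμ.finite
  have hcomp : IsCompact (Φ '' (K ×ˢ univ)) := (hK.prod isCompact_univ).image hΦ
  obtain ⟨t, ht, hcov⟩ := Metric.totallyBounded_iff.1 hcomp.totallyBounded ε hε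
  set U := Submodule.span ℝ t
  have : FiniteDimensional ℝ U := FiniteDimensional.span_of_finite ℝ ht
  have hproj : ∀ p : VarifoldSpace n d, p.1 ∈ K → ‖Φ p - U.starProjection (Φ p)‖ ≤ ε := by
    intro p hp
    obtain ⟨w, hw, hpw⟩ := mem_iUnion₂.1 (hcov ⟨p, ⟨hp, mem_univ _⟩, rfl⟩)
    rw [Submodule.starProjection_minimal]
    refine (ciInf_le ⟨0, ?_⟩ (⟨w, Submodule.subset_span hw⟩ : U)).trans ?_
    · rintro _ ⟨x, rfl⟩
      exact norm_nonneg _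
    · rw [← dist_eq_norm]
      exact (Metric.mem_ball.1 hpw).le
  have hP : Continuous fun p => U.orthogonalProjectionOnto (Φ p) :=
    U.orthogonalProjectionOnto.continuous.comp hΦ
  have hsub : ∀ ν : Measure (VarifoldSpace n d), IsFiniteMeasure ν → (∀ᵐ p ∂ν, p.1 ∈ K) →
      ∫ p, U.starProjection (Φ p) ∂ν = U.subtypeL (∫ p, U.orthogonalProjectionOnto (Φ p) ∂ν) :=
    fun ν _ hν => by
      rw [← ContinuousLinearMap.integral_comp_comm _
        (integrable_of_continuous_of_ae_mem hK hP hν)]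
      rfl
  refine ⟨fun p => U.starProjection (Φ p), U.starProjection.continuous.comp hΦ, ?_, hproj,
    Eventually.of_forall fun _ => hproj⟩
  rw [hsub μ₀ hμ.finite hμ.ae_mem]
  have hlim : Tendsto (fun i => ∫ p, U.orthogonalProjectionOnto (Φ p) ∂(μ i)) l
      (𝓝 (∫ p, U.orthogonalProjectionOnto (Φ p) ∂μ₀)) := by
    refine tendsto_of_tendsto_inner fun e => ?_
    have hin : ∀ ν : Measure (VarifoldSpace n d), IsFiniteMeasure ν → (∀ᵐ p ∂ν, p.1 ∈ K) →
        ∫ p, inner ℝ e (U.orthogonalProjectionOnto (Φ p)) ∂ν =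
          inner ℝ (∫ p, U.orthogonalProjectionOnto (Φ p) ∂ν) e := fun ν _ hν => by
      rw [real_inner_comm e, integral_inner (integrable_of_continuous_of_ae_mem hK hP hν)]
    rw [← hin μ₀ hμ.finite hμ.ae_mem]
    refine (hμ.tendsto_integral_real huniv hK hk (continuous_const.inner hP)).congr' ?_
    filter_upwards [hμ.eventually_finite, hμ.eventually_ae_mem] with i h1 h2 using hin _ h1 h2
  refine ((U.subtypeL.continuous.tendsto _).comp hlim).congr' ?_
  filter_upwards [hμ.eventually_finite, hμ.eventually_ae_mem] with i h1 h2
  exact (hsub _ h1 h2).symm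

/-- Convergence of integrals of locally uniformly convergent functions. -/
lemma tendsto_integral_of_tendsto (huniv : IsC0Universal W) (hK : IsCompact K)
    (hk : Continuous fun p : VarifoldSpace n d => RKHS.kerFun W p (1 : ℝ))
    {F : Type*} [NormedAddCommGroup F] [InnerProductSpace ℝ F] [CompleteSpace F]
    {Φ : VarifoldSpace n d → F} {Φs : ι → VarifoldSpace n d → F} (hΦ : Continuous Φ)
    (hΦs : ∀ i, Continuous (Φs i))
    (h : ∀ p, Tendsto (fun q : ι × VarifoldSpace n d => Φs q.1 q.2) (l ×ˢ 𝓝 p) (𝓝 (Φ p))) :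
    Tendsto (fun i => ∫ p, Φs i p ∂(μ i)) l (𝓝 (∫ p, Φ p ∂μ₀)) := by
  refine hμ.tendsto_integral_of_approx huniv hK hk hΦ hΦs fun ε hε => ?_
  refine ⟨Φ, hΦ, hμ.tendsto_integral huniv hK hk hΦ, fun p _ => by simpa using hε.le, ?_⟩
  have hloc : TendstoLocallyUniformly Φs Φ l := by
    rw [tendstoLocallyUniformly_iff_forall_tendsto]
    intro p
    have h1 : Tendsto (fun q : ι × VarifoldSpace n d => Φ q.2) (l ×ˢ 𝓝 p) (𝓝 (Φ p)) :=
      (hΦ.tendsto p).comp tendsto_snd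
    exact (h1.prodMk_nhds (h p)).mono_right (nhds_le_uniformity (Φ p))
  have hunif := (tendstoLocallyUniformlyOn_iff_tendstoUniformlyOn_of_compact
    (hK.prod (isCompact_univ (X := OrientedGrassmannian n d)))).1 hloc.tendstoLocallyUniformlyOn
  filter_upwards [Metric.tendstoUniformlyOn_iff.1 hunif ε hε] with i hi p hp
  rw [← dist_eq_norm, dist_comm]
  exact (hi p ⟨hp, mem_univ _⟩).le

end MeanConverges

end WeakConvergence

/-! ### Convergence of the energies -/

lemma HasC2Bound.continuous_fderiv_flow {n : ℕ} {V : Type*} [NormedAddCommGroup V]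
    [InnerProductSpace ℝ V] [CompleteSpace V] [RKHS ℝ V (Eucl n) (Eucl n)] {C : ℝ}
    (hC : HasC2Bound V C) (v : L2Path V) : Continuous (fderiv ℝ (flow v 1)) := by
  refine continuous_iff_continuousAt.2 fun x => ?_
  have h := hC.tendsto_fderiv_flow (l := (⊤ : Filter Unit)) (v := fun _ => v) (vbar := v)
    (Eventually.of_forall fun _ => le_rfl) le_rfl (fun g => tendsto_const_nhds) x
  exact h.comp (tendsto_top.prodMk tendsto_id : Tendsto (fun y => ((), y)) (𝓝 x) _)

section Energy

variable {n d : ℕ} {V : Type*} [NormedAddCommGroup V] [InnerProductSpace ℝ V] [CompleteSpace V]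
  [RKHS ℝ V (Eucl n) (Eucl n)]
  {W : Type*} [NormedAddCommGroup W] [InnerProductSpace ℝ W] [CompleteSpace W]
  [RKHS ℝ W (VarifoldSpace n d) ℝ] {ρ γ : ℝ → ℝ} {K : Set (Eucl n)} {lam : ℝ}
  {μ₀ μtar : Measure (VarifoldSpace n d)} [IsFiniteMeasure μtar]
  {ι : Type*} {l : Filter ι} {μ : ι → Measure (VarifoldSpace n d)}
  {v : ι → L2Path V} {vbar : L2Path V}

lemma tendsto_dualDist_varifoldPushforward (hV : EmbedsInC02 V) (hργ : KernelConditions n d ρ γ)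
    (hW : ∀ p q : VarifoldSpace n d, RKHS.kernel W p q 1 = varifoldKernel ρ γ p q)
    (huniv : IsC0Universal W) (hK : IsCompact K) (hμ : MeanConverges W K l μ μ₀)
    {R : ℝ} (hR : ∀ᶠ i in l, ‖v i‖ ≤ R)
    (hw : ∀ g, Tendsto (fun i => inner ℝ (v i) g) l (𝓝 (inner ℝ vbar g))) :
    Tendsto (fun i => dualDist W (varifoldPushforward (flow (v i) 1) (μ i)) μtar) l
      (𝓝 (dualDist W (varifoldPushforward (flow vbar 1) μ₀) μtar)) := by
  obtain ⟨C, hC⟩ := hV.hasC2Bound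
  have hk := continuous_kerFun_one hργ hW
  have hflow : ∀ u : L2Path V, Continuous (flow u 1) := fun u =>
    (hC.differentiable_flow u).continuous
  have hΦ : ∀ u : L2Path V, Continuous fun p : VarifoldSpace n d =>
      pushFeature W (flow u 1 p.1, fderiv ℝ (flow u 1) p.1, p.2) := fun u =>
    (continuous_pushFeature hργ hW).comp (((hflow u).comp continuous_fst).prodMk
      (((hC.continuous_fderiv_flow u).comp continuous_fst).prodMk continuous_snd))
  have htar : Integrable (fun p => RKHS.kerFun W p (1 : ℝ)) μtar :=
    Integrable.of_bound hk.aestronglyMeasurable (√(ρ 0 * γ 1))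
      (Eventually.of_forall fun p => (norm_kerFun_one hW p).le)
  have hdist : ∀ (u : L2Path V) (ν : Measure (VarifoldSpace n d)), IsFiniteMeasure ν →
      (∀ᵐ p ∂ν, p.1 ∈ K) → dualDist W (varifoldPushforward (flow u 1) ν) μtar =
        ‖(∫ p, pushFeature W (flow u 1 p.1, fderiv ℝ (flow u 1) p.1, p.2) ∂ν) -
          meanEmbedding W μtar‖ := fun u ν _ hν => by
    rw [dualDist_eq_norm_sub (integrable_kerFun_varifoldPushforward hργ hW (hflow u)
      (hC.continuous_fderiv_flow u) (integrable_of_continuous_of_ae_mem hK (hΦ u) hν)) htar,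
      meanEmbedding_varifoldPushforward hργ hW (hflow u) (hC.continuous_fderiv_flow u)]
  have hlim : Tendsto (fun i => ∫ p, pushFeature W (flow (v i) 1 p.1,
        fderiv ℝ (flow (v i) 1) p.1, p.2) ∂(μ i)) l
      (𝓝 (∫ p, pushFeature W (flow vbar 1 p.1, fderiv ℝ (flow vbar 1) p.1, p.2) ∂μ₀)) := by
    refine hμ.tendsto_integral_of_tendsto huniv hK hk (hΦ vbar) (fun i => hΦ (v i)) fun p => ?_
    have hR' : ∀ᶠ i in l, ‖v i‖ ≤ max R ‖vbar‖ := hR.mono fun i hi => hi.trans (le_max_left _ _)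
    have hfst : Tendsto (fun q : ι × VarifoldSpace n d => (q.1, q.2.1)) (l ×ˢ 𝓝 p)
        (l ×ˢ 𝓝 p.1) :=
      tendsto_fst.prodMk ((continuous_fst.tendsto p).comp tendsto_snd)
    have h1 := (hC.tendsto_flow hR' (le_max_right _ _) hw p.1).comp hfst
    have h2 := (hC.tendsto_fderiv_flow hR' (le_max_right _ _) hw p.1).comp hfst
    have h3 : Tendsto (fun q : ι × VarifoldSpace n d => q.2.2) (l ×ˢ 𝓝 p) (𝓝 p.2) :=
      (continuous_snd.tendsto p).comp tendsto_snd
    exact ((continuous_pushFeature hργ hW).tendsto _).comp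
      (h1.prodMk_nhds (h2.prodMk_nhds h3))
  rw [hdist vbar μ₀ hμ.finite hμ.ae_mem]
  refine ((hlim.sub_const _).norm).congr' ?_
  filter_upwards [hμ.eventually_finite, hμ.eventually_ae_mem] with i h1 h2
  exact (hdist (v i) (μ i) h1 h2).symm

omit [CompleteSpace V] [CompleteSpace W] [IsFiniteMeasure μtar] in
lemma registrationEnergy_eq (μ : Measure (VarifoldSpace n d)) (v : L2Path V) :
    registrationEnergy W lam μ μtar v = 1 / 2 * ‖v‖ ^ 2 +
      lam * dualDist W (varifoldPushforward (flow v 1) μ) μtar ^ 2 := by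
  rw [registrationEnergy, L2Path.integral_norm_sq]

omit [CompleteSpace V] [CompleteSpace W] [IsFiniteMeasure μtar] in
lemma norm_sq_le_registrationEnergy (hlam : 0 ≤ lam) (μ : Measure (VarifoldSpace n d))
    (v : L2Path V) : 1 / 2 * ‖v‖ ^ 2 ≤ registrationEnergy W lam μ μtar v := by
  rw [registrationEnergy_eq]
  have : 0 ≤ lam * dualDist W (varifoldPushforward (flow v 1) μ) μtar ^ 2 := by positivity
  linarith

lemma tendsto_registrationEnergy (hV : EmbedsInC02 V) (hργ : KernelConditions n d ρ γ)
    (hW : ∀ p q : VarifoldSpace n d, RKHS.kernel W p q 1 = varifoldKernel ρ γ p q)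
    (huniv : IsC0Universal W) (hK : IsCompact K) (hμ : MeanConverges W K l μ μ₀) (w : L2Path V) :
    Tendsto (fun i => registrationEnergy W lam (μ i) μtar w) l
      (𝓝 (registrationEnergy W lam μ₀ μtar w)) := by
  simp_rw [registrationEnergy_eq]
  have h := tendsto_dualDist_varifoldPushforward (μtar := μtar) (v := fun _ => w) hV hργ hW huniv hK
    hμ (Eventually.of_forall fun _ => le_rfl) (fun g => tendsto_const_nhds)
  exact ((h.pow 2).const_mul lam).const_add _

/-- Lower bound for the limit energy along weakly convergent paths. -/
lemma registrationEnergy_le_of_tendsto [l.NeBot] (hlam : 0 ≤ lam) (hV : EmbedsInC02 V)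
    (hργ : KernelConditions n d ρ γ)
    (hW : ∀ p q : VarifoldSpace n d, RKHS.kernel W p q 1 = varifoldKernel ρ γ p q)
    (huniv : IsC0Universal W) (hK : IsCompact K) (hμ : MeanConverges W K l μ μ₀)
    (hw : ∀ g, Tendsto (fun i => inner ℝ (v i) g) l (𝓝 (inner ℝ vbar g)))
    {c : ι → ℝ} {c₀ : ℝ} (hc : Tendsto c l (𝓝 c₀))
    (hle : ∀ᶠ i in l, registrationEnergy W lam (μ i) μtar (v i) ≤ c i) :
    registrationEnergy W lam μ₀ μtar vbar ≤ c₀ := by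
  have hR : ∀ᶠ i in l, ‖v i‖ ≤ √(2 * (c₀ + 1)) := by
    filter_upwards [hle, hc.eventually_lt_const (lt_add_one c₀)] with i h1 h2
    refine Real.le_sqrt_of_sq_le ?_
    have := norm_sq_le_registrationEnergy (W := W) (μtar := μtar) hlam (μ i) (v i)
    linarith
  have hdist := tendsto_dualDist_varifoldPushforward (μtar := μtar) hV hργ hW huniv hK hμ hR hw
  have hlow : Tendsto (fun i => inner ℝ (v i) vbar - 1 / 2 * ‖vbar‖ ^ 2 +
      lam * dualDist W (varifoldPushforward (flow (v i) 1) (μ i)) μtar ^ 2) l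
      (𝓝 (inner ℝ vbar vbar - 1 / 2 * ‖vbar‖ ^ 2 +
        lam * dualDist W (varifoldPushforward (flow vbar 1) μ₀) μtar ^ 2)) :=
    ((hw vbar).sub_const _).add ((hdist.pow 2).const_mul lam)
  have hmain := le_of_tendsto_of_tendsto hlow hc (hle.mono fun i hi => ?_)
  · rw [real_inner_self_eq_norm_sq] at hmain
    rw [registrationEnergy_eq]
    linarith
  · rw [registrationEnergy_eq] at hi
    have h1 := real_inner_le_norm (v i) vbar
    nlinarith [sq_nonneg (‖v i‖ - ‖vbar‖)]

end Energy

lemma tendsto_inner_of_tendsto_weakSpace {H : Type*} [NormedAddCommGroup H] [InnerProductSpace ℝ H]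
    {ι : Type*} {l : Filter ι} {u : ι → WeakSpace ℝ H} {x : WeakSpace ℝ H}
    (h : Tendsto u l (𝓝 x)) (g : H) :
    Tendsto (fun i => inner ℝ ((toWeakSpace ℝ H).symm (u i)) g) l
      (𝓝 (inner ℝ ((toWeakSpace ℝ H).symm x) g)) := by
  have h1 : Continuous fun y : WeakSpace ℝ H => (topDualPairing ℝ H).flip y (innerSL ℝ g) :=
    WeakBilin.eval_continuous _ _
  have h2 := (h1.tendsto x).comp h
  simp_rw [real_inner_comm g]
  exact h2

theorem mainTheorem1 {n d : ℕ} (hd : d ≤ n)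
    {V : Type*} [NormedAddCommGroup V] [InnerProductSpace ℝ V] [CompleteSpace V]
    [RKHS ℝ V (Eucl n) (Eucl n)] (hV : EmbedsInC02 V)
    {W : Type*} [NormedAddCommGroup W] [InnerProductSpace ℝ W] [CompleteSpace W]
    [RKHS ℝ W (VarifoldSpace n d) ℝ]
    (ρ γ : ℝ → ℝ) (hργ : KernelConditions n d ρ γ)
    (hW : ∀ p q : VarifoldSpace n d, RKHS.kernel W p q 1 = varifoldKernel ρ γ p q)
    (huniv : IsC0Universal W)
    (lam : ℝ) (hlam : 0 ≤ lam)
    (μ₀ μtar : Measure (VarifoldSpace n d)) [IsFiniteMeasure μ₀] [IsFiniteMeasure μtar]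
    (K : Set (Eucl n)) (hK : IsCompact K) (hμ₀ : (weightMeasure μ₀).support ⊆ K)
    (μK : ℕ → Measure (VarifoldSpace n d))
    (hμK : ∀ N, 1 ≤ N → IsConstrainedProjection W μ₀ K N (μK N)) :
    GammaConverges (X := WeakSpace ℝ (L2Path V))
      (fun N v => registrationEnergy W lam (μK N) μtar ((toWeakSpace ℝ (L2Path V)).symm v))
      (fun v => registrationEnergy W lam μ₀ μtar ((toWeakSpace ℝ (L2Path V)).symm v)) ∧
    ∀ v : ℕ → L2Path V,
      (∀ N, 1 ≤ N → ∀ w : L2Path V, registrationEnergy W lam (μK N) μtar (v N) ≤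
        registrationEnergy W lam (μK N) μtar w) →
      (∃ C : ℝ, ∀ N, 1 ≤ N → ‖v N‖ ≤ C) ∧
      ∀ vbar : L2Path V,
        MapClusterPt (toWeakSpace ℝ (L2Path V) vbar) atTop
          (fun N => toWeakSpace ℝ (L2Path V) (v N)) →
        ∀ w : L2Path V, registrationEnergy W lam μ₀ μtar vbar ≤
          registrationEnergy W lam μ₀ μtar w := by
  have hae := ae_mem_of_support_weightMeasure_subset hμ₀
  have hμ : MeanConverges W K atTop μK μ₀ :=
    ⟨(eventually_ge_atTop 1).mono fun N hN => isFiniteMeasure_of_mem_discreteVarifolds (hμK N hN).1,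
      inferInstance,
      (eventually_ge_atTop 1).mono fun N hN =>
        ae_mem_of_support_weightMeasure_subset (hμK N hN).2.1, hae,
      tendsto_meanEmbedding_constrainedProjection hd (continuous_kerFun_one hργ hW) hK hae hμK⟩
  have hlim : ∀ w : L2Path V, Tendsto (fun N => registrationEnergy W lam (μK N) μtar w) atTop
      (𝓝 (registrationEnergy W lam μ₀ μtar w)) :=
    tendsto_registrationEnergy hV hργ hW huniv hK hμ
  refine ⟨⟨fun x u hu => ?_, fun x => ⟨fun _ => x, tendsto_const_nhds, ?_⟩⟩, fun v hv => ⟨?_, ?_⟩⟩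
  · by_contra! hlt
    obtain ⟨c, hc1, hc2⟩ := EReal.lt_iff_exists_real_btwn.1 hlt
    have hfreq := frequently_lt_of_liminf_lt (by isBoundedDefault) hc1
    set S : Set ℕ := {N | ((registrationEnergy W lam (μK N) μtar
      ((toWeakSpace ℝ (L2Path V)).symm (u N)) : ℝ) : EReal) < c}
    have hne : (atTop ⊓ 𝓟 S).NeBot := frequently_mem_iff_neBot.1 hfreq
    refine absurd (EReal.coe_lt_coe_iff.1 hc2) (not_lt.2 ?_)
    refine registrationEnergy_le_of_tendsto (l := atTop ⊓ 𝓟 S) hlam hV hργ hW huniv hK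
      (hμ.mono inf_le_left) (tendsto_inner_of_tendsto_weakSpace (hu.mono_left inf_le_left))
      tendsto_const_nhds ?_
    exact mem_inf_of_right fun N hN => (EReal.coe_lt_coe_iff.1 hN).le
  · exact ((continuous_coe_real_ereal.tendsto _).comp (hlim _)).limsup_eq.le
  · obtain ⟨B, hB⟩ := (hlim 0).bddAbove_range
    refine ⟨√(2 * B), fun N hN => Real.le_sqrt_of_sq_le ?_⟩
    have h1 := norm_sq_le_registrationEnergy (W := W) (μtar := μtar) hlam (μK N) (v N)
    have h2 := hv N hN 0
    have h3 : registrationEnergy W lam (μK N) μtar (0 : L2Path V) ≤ B := hB ⟨N, rfl⟩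
    linarith
  · intro vbar hcl w
    obtain ⟨U, hU, hUt⟩ := mapClusterPt_iff_ultrafilter.1 hcl
    refine registrationEnergy_le_of_tendsto (v := v) hlam hV hργ hW huniv hK (hμ.mono hU)
      (fun g => ?_) ((hlim w).mono_left hU) (hU ?_)
    · simpa using tendsto_inner_of_tendsto_weakSpace hUt g
    · exact (eventually_ge_atTop 1).mono fun N hN => hv N hN w
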